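/- **Setting.** Let $d\ge 0$, $n\ge 1$, $\gamma\in\mathbb R$, $\eta_\alpha,\lambda_\alpha\in\mathbb R$ $(1\le\alpha\le d)$, $T\ge 0$, $\varepsilon>0$. Write $\sigma_{ab}=|a\rangle\langle b|$. On $n$ qubits (qubit $1$ being the rightmost tensor factor) put $$s_j^-=I^{\otimes(n-j)}\otimes\sigma_{01}\otimes\sigma_{10}^{\otimes(j-1)},\qquad s_j^+=(s_j^-)^\dagger,$$ and on $d$ registers of $n$ qubits each consider the Hamiltonian $$\mathcal H=\gamma\sum_{\alpha=1}^d\sum_{j=1}^n\eta_\alpha\left(e^{i\lambda_\alpha}(s_j^-)_\alpha+e^{-i\lambda_\alpha}(s_j^+)_\alpha\right),$$ where $(A)_\alpha$ is $A$ acting on the $\alpha$-th register. Let $$U_j(\lambda)=\Big(\prod_{m<j}\mathrm{CNOT}^j_m\Big)P_j(\lambda)H_j$$ ($H_j$ the Hadamard gate and $P_j(\lambda)=\mathrm{diag}(1,e^{i\lambda})$ on qubit $j$, $\mathrm{CNOT}^j_m$ with control $j$ and target $m$), and let $\mathrm{CRZ}_j(\theta)$ be the rotation $\exp(-i\theta Z_j/2)$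 of qubit $j$ controlled by qubits $1,\dots,j-1$. Put $$W_j(\theta,\lambda)=U_j(-\lambda)\,\mathrm{CRZ}_j(2\theta)\,U_j(-\lambda)^\dagger,\qquad V(\theta,\lambda)=W_n(\theta,\lambda)\cdots W_2(\theta,\lambda)W_1(\theta,\lambda),$$ $$V^{(2)}(\theta,\lambda)=W_1(\theta/2,\lambda)\,V(\theta,\lambda)\,W_1(-\theta/2,\lambda).$$ Circuits are composed of arbitrary single-qubit gates and CNOT gates on exactly the $dn$ qubits (no ancillas); the non-local gates are the CNOTs. Set $$B=\frac{d\,n^{2.5}\,|\gamma|^{1.5}\,T^{1.5}\left(\sum_{\alpha}|\eta_\alpha|^3\right)^{0.5}}{\varepsilon^{0.5}},\qquad \Lambda=\frac{n\,|\gamma|^3\,T^3\sum_\alpha|\eta_\alpha|^3}{\varepsilon}.$$ **Theorem.** For all $d,n$ and all angles $\theta_\alpha,\lambda_\alpha$ there is a circuit that implements $\bigotimes_{\alpha=1}^d V^{(2)}(\theta_\alpha,\lambda_\alpha)$ exactly, and for all parameters as above there is an integer $r\ge 1$, such that the circuit that applies the one for $\bigotimes_{\alpha}V^{(2)}(\gamma\eta_\alpha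 T/r,\lambda_\alpha)$ exactly $r$ times in succession implements $\exp(-i\mathcal HT)$ within additive error $\varepsilon$ in operator norm, and the number $N$ of its non-local gates satisfies the following. 1. $N=O(B)$ in the regime where $\Lambda$ is bounded below: for every $c>0$ there is a constant $K$ depending only on $c$ with $N\le K\,B$ whenever $\Lambda\ge c$. 2. The leading term of $N$ is $$3\sqrt3\,B=\frac{3\sqrt3\,d\,n^{2.5}|\gamma|^{1.5}T^{1.5}\left(\sum_\alpha|\eta_\alpha|^3\right)^{0.5}}{\varepsilon^{0.5}}:$$ for every $\delta>0$ there are $n_0$ and $R$, depending only on $\delta$, such that $\left|N-3\sqrt3\,B\right|\le\delta\cdot 3\sqrt3\,B$ whenever $n\ge n_0$ and $\Lambda\ge R$. -/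

import Mathlib

open scoped Matrix.Norms.L2Operator

noncomputable section

namespace QSim

/-! ### Qubit operators

The state space of a register whose qubits are labelled by `ι` has the computational basis
`ι → Fin 2`. Operators are complex matrices in this basis; the norm is the operator norm
induced by the Euclidean norm. -/

/-- Operators on a register with qubits labelled by `ι`. -/
abbrev Op (ι : Type) : Type := Matrix (ι → Fin 2) (ι → Fin 2) ℂ

/-- Tensor product of one-qubit operators, `A q` acting on qubit `q`. -/
def tensor {ι : Type} [Fintype ι] (A : ι → Matrix (Fin 2) (Fin 2) ℂ) : Op ι :=
  Matrix.of fun x y => ∏ q, A q (x q) (y q)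

/-- The one-qubit operator `A` acting on qubit `q`, the identity on the other qubits. -/
def onQubit {ι : Type} [Fintype ι] [DecidableEq ι] (q : ι) (A : Matrix (Fin 2) (Fin 2) ℂ) :
    Op ι :=
  tensor (Function.update (fun _ => 1) q A)

def sigma00 : Matrix (Fin 2) (Fin 2) ℂ := !![1, 0; 0, 0]
def sigma01 : Matrix (Fin 2) (Fin 2) ℂ := !![0, 1; 0, 0]
def sigma10 : Matrix (Fin 2) (Fin 2) ℂ := !![0, 0; 1, 0]
def sigma11 : Matrix (Fin 2) (Fin 2) ℂ := !![0, 0; 0, 1]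
def pauliX : Matrix (Fin 2) (Fin 2) ℂ := !![0, 1; 1, 0]

/-- The Hadamard gate. -/
def hadamard : Matrix (Fin 2) (Fin 2) ℂ := ((Real.sqrt 2 : ℝ) : ℂ)⁻¹ • !![1, 1; 1, -1]

/-- The phase gate `diag(1, e^{i lam})`. -/
def phaseGate (lam : ℝ) : Matrix (Fin 2) (Fin 2) ℂ :=
  !![1, 0; 0, Complex.exp (Complex.I * lam)]

/-- The rotation `exp (-i θ Z / 2) = diag(e^{-iθ/2}, e^{iθ/2})`. -/
def rz (θ : ℝ) : Matrix (Fin 2) (Fin 2) ℂ :=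
  !![Complex.exp (-(Complex.I * θ / 2)), 0; 0, Complex.exp (Complex.I * θ / 2)]

/-- The CNOT with control `c` and target `t` (for `c ≠ t`):
`|0⟩⟨0|` on `c`, plus `|1⟩⟨1|` on `c` times `X` on `t`. -/
def cnot {ι : Type} [Fintype ι] [DecidableEq ι] (c t : ι) : Op ι :=
  onQubit c sigma00 + tensor (Function.update (Function.update (fun _ => 1) t pauliX) c sigma11)

/-! ### Quantum circuits of single-qubit gates and CNOT gates -/

/-- Elementary gates: an arbitrary single-qubit unitary, or a CNOT with distinct control `c`
and target `t`. -/
inductive Gate (ι : Type) : Type where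
  | single (q : ι) (U : Matrix.unitaryGroup (Fin 2) ℂ) : Gate ι
  | cnot (c t : ι) (h : c ≠ t) : Gate ι

/-- The operator of a gate. -/
def Gate.toOp {ι : Type} [Fintype ι] [DecidableEq ι] : Gate ι → Op ι
  | .single q U => onQubit q (U : Matrix (Fin 2) (Fin 2) ℂ)
  | .cnot c t _ => QSim.cnot c t

/-- The number of non-local (CNOT) gates in a single gate. -/
def Gate.nonlocal {ι : Type} : Gate ι → ℕ
  | .single _ _ => 0
  | .cnot _ _ _ => 1

/-- A circuit: the list of its gates in the order in which they are applied. -/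
abbrev Circuit (ι : Type) : Type := List (Gate ι)

/-- The operator of a circuit; the first gate of the list acts first, so it is the rightmost
factor. -/
def Circuit.toOp {ι : Type} [Fintype ι] [DecidableEq ι] (C : Circuit ι) : Op ι :=
  (C.map Gate.toOp).reverse.prod

/-- The number of non-local gates of a circuit. -/
def Circuit.nonlocalCount {ι : Type} (C : Circuit ι) : ℕ := (C.map Gate.nonlocal).sum

/-- The circuit `C` applied `r` times in succession. -/
def Circuit.iter {ι : Type} (C : Circuit ι) (r : ℕ) : Circuit ι := (List.replicate r C).flatten

/-! ### One spatial dimension: `n` qubits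

Qubit `j ∈ {1, …, n}` is represented by `j - 1 : Fin n`; qubit `1` is the least significant
one, i.e. the rightmost tensor factor. -/

/-- `s⁻_j = I^{⊗(n-j)} ⊗ σ₀₁ ⊗ σ₁₀^{⊗(j-1)}`. -/
def sMinus {n : ℕ} (j : Fin n) : Op (Fin n) :=
  tensor fun k => if k = j then sigma01 else if k < j then sigma10 else 1

/-- `s⁺_j = I^{⊗(n-j)} ⊗ σ₁₀ ⊗ σ₀₁^{⊗(j-1)}`. -/
def sPlus {n : ℕ} (j : Fin n) : Op (Fin n) :=
  tensor fun k => if k = j then sigma10 else if k < j then sigma01 else 1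

/-- The Bell-basis unitary `U_j(lam) = (∏_{m < j} CNOT^j_m) P_j(lam) H_j` (control `j`,
targets `m`). -/
def bellU {n : ℕ} (j : Fin n) (lam : ℝ) : Op (Fin n) :=
  (((List.finRange n).filter (fun m => m < j)).map (fun m => cnot j m)).prod
    * onQubit j (phaseGate lam) * onQubit j hadamard

/-- The multi-controlled `RZ(θ)` gate acting on qubit `j`, controlled by all qubits `k < j`:
`exp(-iθ Z_j / 2) ⊗ |1⟩⟨1|^{⊗(j-1)} + I ⊗ (I - |1⟩⟨1|^{⊗(j-1)})`. -/
def mcrz {n : ℕ} (j : Fin n) (θ : ℝ) : Op (Fin n) :=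
  tensor (fun k => if k = j then rz θ else if k < j then sigma11 else 1)
    + (1 - tensor (fun k => if k < j then sigma11 else 1))

/-- `W_j(θ, lam) = U_j(-lam) CRZ_j(2θ) U_j(-lam)†`. -/
def W {n : ℕ} (j : Fin n) (θ lam : ℝ) : Op (Fin n) :=
  bellU j (-lam) * mcrz j (2 * θ) * (bellU j (-lam)).conjTranspose

/-- The first-order step `V(θ, lam)`: the unitaries `W_1, W_2, …, W_n` are applied in this order,
so the operator is `W_n ⋯ W_2 W_1`. -/
def V (n : ℕ) (θ lam : ℝ) : Op (Fin n) :=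
  ((List.finRange n).map (fun j => W j θ lam)).reverse.prod

/-- The second-order step `V⁽²⁾(θ, lam) = W_1(θ/2, lam) V(θ, lam) W_1(-θ/2, lam)`. -/
def V2 {n : ℕ} (hn : 0 < n) (θ lam : ℝ) : Op (Fin n) :=
  W ⟨0, hn⟩ (θ / 2) lam * V n θ lam * W ⟨0, hn⟩ (-θ / 2) lam

/-! ### `d` spatial dimensions: `d` registers of `n` qubits each -/

/-- `⨂_α A_α`, the operator `A α` acting on the `α`-th register of `n` qubits. -/
def regTensor {d n : ℕ} (A : Fin d → Op (Fin n)) : Op (Fin d × Fin n) :=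
  Matrix.of fun x y => ∏ α, A α (fun k => x (α, k)) (fun k => y (α, k))

/-- `(A)_α = I^{⊗(α-1)n} ⊗ A ⊗ I^{⊗(d-α)n}`. -/
def onReg {d n : ℕ} (α : Fin d) (A : Op (Fin n)) : Op (Fin d × Fin n) :=
  regTensor (Function.update (fun _ => 1) α A)

/-- The Hamiltonian
`γ ∑_α ∑_j η_α (e^{i lam_α} (s⁻_j)_α + e^{-i lam_α} (s⁺_j)_α)`. -/
def hamiltonian {d : ℕ} (n : ℕ) (γ : ℝ) (η lam : Fin d → ℝ) : Op (Fin d × Fin n) :=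
  (γ : ℂ) • ∑ α, ∑ j : Fin n, (η α : ℂ) •
    (Complex.exp (Complex.I * lam α) • onReg α (sMinus j)
      + Complex.exp (-(Complex.I * lam α)) • onReg α (sPlus j))

/-- The `d`-dimensional second-order step `⨂_α V⁽²⁾(θ_α, lam_α)`. -/
def stepOp {d n : ℕ} (hn : 0 < n) (θ lam : Fin d → ℝ) : Op (Fin d × Fin n) :=
  regTensor fun α => V2 hn (θ α) (lam α)

/-- A simulation task: the data of the Hamiltonian, the total time `T` and the admissible
additive error `ε`. -/
structure Task where
  d : ℕ
  n : ℕ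
  n_pos : 0 < n
  γ : ℝ
  η : Fin d → ℝ
  lam : Fin d → ℝ
  T : ℝ
  T_nonneg : 0 ≤ T
  ε : ℝ
  ε_pos : 0 < ε

namespace Task

/-- The Hamiltonian of the task. -/
def H (P : Task) : Op (Fin P.d × Fin P.n) := hamiltonian P.n P.γ P.η P.lam

/-- The exact evolution `exp(-i H T)`. -/
def evolution (P : Task) : Op (Fin P.d × Fin P.n) :=
  NormedSpace.exp ((-(Complex.I * (P.T : ℂ))) • P.H)

/-- The angles `γ η_α τ` of one step of length `τ = T / r`. -/
def angles (P : Task) (r : ℕ) (α : Fin P.d) : ℝ := P.γ * P.η α * (P.T / r)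

/-- `d n^{2.5} |γ|^{1.5} T^{1.5} (∑_α |η_α|³)^{0.5} / ε^{0.5}`. -/
def scale (P : Task) : ℝ :=
  P.d * (P.n : ℝ) ^ (5 / 2 : ℝ) * |P.γ| ^ (3 / 2 : ℝ) * P.T ^ (3 / 2 : ℝ)
    * Real.sqrt (∑ α, |P.η α| ^ 3) / Real.sqrt P.ε

/-- `n |γ|³ T³ ∑_α |η_α|³ / ε`: up to a constant factor, the square of the number of second-order
steps that the error budget `ε` calls for. -/
def load (P : Task) : ℝ :=
  P.n * |P.γ| ^ 3 * P.T ^ 3 * (∑ α, |P.η α| ^ 3) / P.ε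

end Task

end QSim

end

/-! Error. Conjugation by the Bell unitary turns the generator of the controlled rotation into the
hopping term `hop j lam`, so `W j θ lam` is exactly `exp (-iθ hop j)`. Two different hopping terms,
neither of them on the lowest qubit, multiply to zero. Hence the terms above the first commute and
sum to one operator `tailHam`, and `V2` is exactly the Strang splitting of `hop 0 + tailHam`
(`V2_eq_strang`). Both summands are self-adjoint with cube equal to themselves, so their norms are
at most 1, and a Taylor argument bounds the error of one step by `|θ|^3 / 2`, uniformly in `n`
(`norm_strang_sub_exp_le`). Errors add over registers and over repetitions by telescoping.

Cost. A rotation with `k` controls is a group commutator of two multi-controlled reflections, each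
controlled by half of the controls (`toOp_mcrzCircuit`). Each half serves as borrowed qubits for the
other, so no ancilla is needed. A multi-controlled `X` with `m ≥ 2` controls costs `8 (m - 1)` CNOTs
through a ladder of open controlled Hadamards, each with a single CNOT (`toOp_mcxLadder`). The four
`X` gates cost about `16 k` and the two Bell unitaries `2 k`; summing `18 k` over `k < n` gives `9
n^2 + O(n)`.

Balance. The step error is used in the weaker form `(n / 3) |θ|^3`. Then `r = ⌈√(Λ / 3)⌉` steps (at
least one) suffice, and `d · 9 n^2 · √(Λ / 3) = 3√3 · d n^2 √Λ = 3√3 B`. The remaining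
discrepancies, rounding of `r` and the linear term in the step count, are relatively small for large
`Λ` and `n`. -/

noncomputable section

namespace QSim

/-! ### Tensor products and operators localised on sets of qubits -/

section Tensor

variable {ι : Type} [Fintype ι]

theorem tensor_mul [DecidableEq ι] (A B : ι → Matrix (Fin 2) (Fin 2) ℂ) :
    tensor A * tensor B = tensor (fun q => A q * B q) := by
  ext x y
  simp only [tensor, Matrix.mul_apply, Matrix.of_apply, ← Finset.prod_mul_distrib]
  exact (Fintype.prod_sum fun q b => A q (x q) b * B q b (y q)).symm

theorem tensor_one [DecidableEq ι] :
    tensor (fun _ : ι => (1 : Matrix (Fin 2) (Fin 2) ℂ)) = 1 := by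
  ext x y
  by_cases h : x = y
  · subst h; simp [tensor]
  · obtain ⟨q, hq⟩ := Function.ne_iff.mp h
    rw [Matrix.one_apply_ne h]
    exact Finset.prod_eq_zero (Finset.mem_univ q) (Matrix.one_apply_ne hq)

theorem tensor_eq_zero (A : ι → Matrix (Fin 2) (Fin 2) ℂ) (q : ι) (h : A q = 0) :
    tensor A = 0 := by
  ext x y
  exact Finset.prod_eq_zero (Finset.mem_univ q) (by simp [h])

theorem tensor_conjTranspose (A : ι → Matrix (Fin 2) (Fin 2) ℂ) :
    (tensor A).conjTranspose = tensor (fun q => (A q).conjTranspose) := by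
  ext x y
  simp [tensor, Matrix.conjTranspose_apply]

theorem tensor_diagonal [DecidableEq ι] (v : ι → Fin 2 → ℂ) :
    tensor (fun q => Matrix.diagonal (v q)) = Matrix.diagonal (fun x => ∏ q, v q (x q)) := by
  ext x y
  by_cases h : x = y
  · subst h; simp [tensor]
  · obtain ⟨q, hq⟩ := Function.ne_iff.mp h
    rw [Matrix.diagonal_apply_ne _ h]
    exact Finset.prod_eq_zero (Finset.mem_univ q) (Matrix.diagonal_apply_ne _ hq)

variable [DecidableEq ι]

theorem onQubit_apply (q : ι) (A : Matrix (Fin 2) (Fin 2) ℂ) (x y : ι → Fin 2) :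
    onQubit q A x y = A (x q) (y q) *
      ∏ k ∈ Finset.univ.erase q, (1 : Matrix (Fin 2) (Fin 2) ℂ) (x k) (y k) := by
  rw [onQubit, tensor, Matrix.of_apply, ← Finset.mul_prod_erase _ _ (Finset.mem_univ q)]
  congr 1
  · simp
  · exact Finset.prod_congr rfl fun k hk => by simp [Function.update_of_ne (Finset.ne_of_mem_erase hk)]

/-- The algebra homomorphism sending a one-qubit operator to its action on qubit `q`. -/
def onQubitHom (q : ι) : Matrix (Fin 2) (Fin 2) ℂ →ₐ[ℂ] Op ι where
  toFun := onQubit q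
  map_one' := by
    rw [onQubit, ← tensor_one]
    congr 1
    exact Function.update_eq_self q _
  map_mul' A B := by
    rw [onQubit, onQubit, onQubit, tensor_mul]
    congr 1
    ext1 k
    by_cases h : k = q
    · subst h; simp
    · simp [Function.update_of_ne h]
  map_zero' := tensor_eq_zero _ q (by simp)
  map_add' A B := by
    ext x y
    simp only [Matrix.add_apply, onQubit_apply, add_mul]
  commutes' c := by
    have h1 : onQubit q (1 : Matrix (Fin 2) (Fin 2) ℂ) = 1 := by
      rw [onQubit, ← tensor_one]
      congr 1
      exact Function.update_eq_self q _
    rw [Algebra.algebraMap_eq_smul_one, Algebra.algebraMap_eq_smul_one, ← h1]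
    ext x y
    simp only [Matrix.smul_apply, onQubit_apply, smul_eq_mul, mul_assoc]

theorem onQubit_one (q : ι) : onQubit q 1 = 1 := map_one (onQubitHom q)
theorem onQubit_mul (q : ι) (A B : Matrix (Fin 2) (Fin 2) ℂ) :
    onQubit q (A * B) = onQubit q A * onQubit q B := map_mul (onQubitHom q) A B
theorem onQubit_add (q : ι) (A B : Matrix (Fin 2) (Fin 2) ℂ) :
    onQubit q (A + B) = onQubit q A + onQubit q B := map_add (onQubitHom q) A B

theorem onQubit_conjTranspose (q : ι) (A : Matrix (Fin 2) (Fin 2) ℂ) :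
    (onQubit q A).conjTranspose = onQubit q A.conjTranspose := by
  rw [onQubit, tensor_conjTranspose, onQubit]
  congr 1
  ext1 k
  by_cases h : k = q
  · subst h; simp
  · simp [Function.update_of_ne h]

theorem onQubit_commute {q q' : ι} (h : q ≠ q') (A B : Matrix (Fin 2) (Fin 2) ℂ) :
    Commute (onQubit q A) (onQubit q' B) := by
  rw [Commute, SemiconjBy, onQubit, onQubit, tensor_mul, tensor_mul]
  congr 1
  ext1 k
  by_cases h1 : k = q
  · subst h1; simp [Function.update_of_ne h]
  · simp [Function.update_of_ne h1]

theorem onQubit_mul_tensor (q : ι) (A : Matrix (Fin 2) (Fin 2) ℂ)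
    (B : ι → Matrix (Fin 2) (Fin 2) ℂ) :
    onQubit q A * tensor B = tensor (Function.update B q (A * B q)) := by
  rw [onQubit, tensor_mul]
  congr 1
  ext1 k
  by_cases h : k = q
  · subst h; simp
  · simp [Function.update_of_ne h]

theorem cnot_eq {c t : ι} (h : c ≠ t) :
    cnot c t = onQubit c sigma00 + onQubit c sigma11 * onQubit t pauliX := by
  rw [cnot, onQubit.eq_1 t, onQubit_mul_tensor, Function.update_of_ne h, mul_one]

/-- The algebra of the operators that act on the qubits of `S` only. -/
def localAlg (S : Set ι) : Subalgebra ℂ (Op ι) :=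
  Algebra.adjoin ℂ {U | ∃ q ∈ S, ∃ A, U = onQubit q A}

theorem onQubit_mem_localAlg {S : Set ι} {q : ι} (h : q ∈ S) (A : Matrix (Fin 2) (Fin 2) ℂ) :
    onQubit q A ∈ localAlg S := Algebra.subset_adjoin ⟨q, h, A, rfl⟩

theorem localAlg_mono {S T : Set ι} (h : S ⊆ T) : localAlg S ≤ localAlg T :=
  Algebra.adjoin_mono fun _ ⟨q, hq, A, e⟩ => ⟨q, h hq, A, e⟩

theorem cnot_mem_localAlg {S : Set ι} {c t : ι} (h : c ≠ t) (hc : c ∈ S) (ht : t ∈ S) :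
    cnot c t ∈ localAlg S := by
  rw [cnot_eq h]
  exact add_mem (onQubit_mem_localAlg hc _)
    (mul_mem (onQubit_mem_localAlg hc _) (onQubit_mem_localAlg ht _))

theorem localAlg_commute_onQubit {S : Set ι} {q : ι} (h : q ∉ S) {U : Op ι}
    (hU : U ∈ localAlg S) (A : Matrix (Fin 2) (Fin 2) ℂ) : Commute U (onQubit q A) := by
  refine (Algebra.commute_of_mem_adjoin_of_forall_mem_commute hU ?_).symm
  rintro _ ⟨q', hq', B, rfl⟩
  exact onQubit_commute (fun e : q = q' => h (e ▸ hq')) A B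

/-- Commutation need only be checked on the one-qubit generators. This lets the circuit identities
below be proved algebraically, without basis computations. -/
theorem localAlg_commute {S T : Set ι} (h : Disjoint S T) {U V : Op ι}
    (hU : U ∈ localAlg S) (hV : V ∈ localAlg T) : Commute U V := by
  refine Algebra.commute_of_mem_adjoin_of_forall_mem_commute hV ?_
  rintro _ ⟨q, hq, B, rfl⟩
  exact localAlg_commute_onQubit (fun h' => Set.disjoint_left.mp h h' hq) hU B

end Tensor

/-! ### Algebra of controlled operators -/

section Control

variable {R : Type*} [Ring R]

/-- `u` controlled by the projection `p`. -/
def ctl (p u : R) : R := 1 - p + p * u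

theorem ctl_one (p : R) : ctl p 1 = 1 := by simp [ctl]

theorem ctl_one_left (u : R) : ctl 1 u = u := by simp [ctl]

theorem ctl_mul {p u : R} (hp : p * p = p) (hu : Commute p u) (v : R) :
    ctl p u * ctl p v = ctl p (u * v) := by
  have hu : p * u = u * p := hu
  have h1 : p * u * p = p * u := by rw [mul_assoc, ← hu, ← mul_assoc, hp]
  simp only [ctl, mul_add, add_mul, mul_sub, sub_mul, one_mul, mul_one, hp, ← mul_assoc, h1]
  abel

theorem ctl_conj {p a b u : R} (ha : Commute p a) (hab : a * b = 1) :
    a * ctl p u * b = ctl p (a * u * b) := by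
  have ha : a * p = p * a := ha.symm
  have h1 : a * p * b = p := by rw [ha, mul_assoc, hab, mul_one]
  simp only [ctl, mul_add, add_mul, mul_sub, sub_mul, mul_one, hab, ← mul_assoc, h1]
  rw [ha]

theorem ctl_ctl (p q u : R) : ctl p (ctl q u) = ctl (p * q) u := by
  simp only [ctl, mul_add, mul_sub, mul_one, mul_assoc]
  abel

theorem ctl_commute {p u v : R} (hp : Commute v p) (hu : Commute v u) : Commute v (ctl p u) :=
  ((Commute.one_right v).sub_right hp).add_right (hp.mul_right hu)

/-- Where `p` vanishes only `v * v = 1` remains, so `v` itself needs no control: controlling one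
factor of a commutator controls the whole. -/
theorem ctl_commutator {p u v : R} (hp : p * p = p) (hpu : Commute p u) (hpv : Commute p v)
    (hv : v * v = 1) : ctl p u * v * ctl p u * v = ctl p (u * v * u * v) := by
  have h := ctl_conj (u := u) hpv hv
  rw [mul_assoc, mul_assoc, ← mul_assoc v, h, ctl_mul hp hpu]
  simp only [mul_assoc]

end Control

/-! ### Semantics, inversion and CNOT counts of circuits -/

section Circuits

variable {ι : Type}

theorem Circuit.nonlocalCount_append (C D : Circuit ι) :
    Circuit.nonlocalCount (C ++ D) = C.nonlocalCount + D.nonlocalCount := by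
  simp [Circuit.nonlocalCount]

theorem Circuit.nonlocalCount_flatten (L : List (Circuit ι)) :
    Circuit.nonlocalCount L.flatten = (L.map Circuit.nonlocalCount).sum := by
  induction L with
  | nil => rfl
  | cons C L ih => rw [List.flatten_cons, nonlocalCount_append, ih, List.map_cons, List.sum_cons]

theorem Circuit.nonlocalCount_iter (C : Circuit ι) (r : ℕ) :
    (C.iter r).nonlocalCount = r * C.nonlocalCount := by
  rw [Circuit.iter, nonlocalCount_flatten, List.map_replicate, List.sum_replicate, smul_eq_mul]

/-- The inverse gate. -/
def Gate.inv : Gate ι → Gate ι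
  | .single q U => .single q U⁻¹
  | .cnot c t h => .cnot c t h

/-- The inverse circuit. -/
def Circuit.inv (C : Circuit ι) : Circuit ι := (C.map Gate.inv).reverse

theorem Circuit.nonlocalCount_inv (C : Circuit ι) : C.inv.nonlocalCount = C.nonlocalCount := by
  rw [Circuit.nonlocalCount, Circuit.inv, List.map_reverse, List.sum_reverse, List.map_map,
    Circuit.nonlocalCount]
  congr 1
  exact List.map_congr_left fun g _ => by cases g <;> rfl

/-- The CNOT circuit with control `c` and target `t`, for `c ≠ t`. -/
def cx [DecidableEq ι] (c t : ι) : Circuit ι := if h : c ≠ t then [Gate.cnot c t h] else []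

theorem nonlocalCount_cx [DecidableEq ι] {c t : ι} (h : c ≠ t) :
    (cx c t).nonlocalCount = 1 := by
  rw [cx, dif_pos h]; rfl

variable [Fintype ι] [DecidableEq ι]

theorem Circuit.toOp_nil : Circuit.toOp ([] : Circuit ι) = 1 := rfl

theorem Circuit.toOp_append (C D : Circuit ι) :
    Circuit.toOp (C ++ D) = D.toOp * C.toOp := by
  simp [Circuit.toOp]

theorem Circuit.toOp_cons (g : Gate ι) (C : Circuit ι) :
    Circuit.toOp (g :: C) = C.toOp * g.toOp := by
  simp [Circuit.toOp]

theorem Circuit.toOp_flatten (L : List (Circuit ι)) :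
    Circuit.toOp L.flatten = (L.map Circuit.toOp).reverse.prod := by
  induction L with
  | nil => rfl
  | cons C L ih => rw [List.flatten_cons, toOp_append, ih]; simp

theorem Circuit.toOp_iter (C : Circuit ι) (r : ℕ) : (C.iter r).toOp = C.toOp ^ r := by
  rw [Circuit.iter, toOp_flatten, List.map_replicate, List.reverse_replicate, List.prod_replicate]

theorem toOp_cx {c t : ι} (h : c ≠ t) : (cx c t).toOp = cnot c t := by
  rw [cx, dif_pos h]; simp [Circuit.toOp, Gate.toOp]

theorem pauliX_mul_self : pauliX * pauliX = 1 := by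
  ext i j; fin_cases i <;> fin_cases j <;> simp [pauliX, Matrix.mul_apply]

theorem sigma11_mul_self : sigma11 * sigma11 = sigma11 := by
  ext i j; fin_cases i <;> fin_cases j <;> simp [sigma11, Matrix.mul_apply]

theorem sigma00_eq : sigma00 = 1 - sigma11 := by
  ext i j; fin_cases i <;> fin_cases j <;> simp [sigma00, sigma11]

theorem cnot_eq_ctl {c t : ι} (h : c ≠ t) :
    cnot c t = ctl (onQubit c sigma11) (onQubit t pauliX) := by
  rw [cnot_eq h, ctl, sigma00_eq]
  congr 1
  exact (map_sub (onQubitHom c) _ _).trans (by rw [map_one]; rfl)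

theorem cnot_mul_self {c t : ι} (h : c ≠ t) : cnot c t * cnot c t = 1 := by
  rw [cnot_eq_ctl h, ctl_mul (by rw [← onQubit_mul, sigma11_mul_self]) (onQubit_commute h _ _),
    ← onQubit_mul, pauliX_mul_self, onQubit_one, ctl_one]

theorem cnot_conjTranspose {c t : ι} (h : c ≠ t) : (cnot c t).conjTranspose = cnot c t := by
  have h0 : sigma00.conjTranspose = sigma00 := by
    ext i j; fin_cases i <;> fin_cases j <;> simp [sigma00]
  have h1 : sigma11.conjTranspose = sigma11 := by
    ext i j; fin_cases i <;> fin_cases j <;> simp [sigma11]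
  have hX : pauliX.conjTranspose = pauliX := by
    ext i j; fin_cases i <;> fin_cases j <;> simp [pauliX]
  rw [cnot_eq h, Matrix.conjTranspose_add, Matrix.conjTranspose_mul, onQubit_conjTranspose,
    onQubit_conjTranspose, onQubit_conjTranspose, h0, h1, hX, (onQubit_commute h _ _).eq]

theorem Gate.toOp_inv (g : Gate ι) : g.inv.toOp = g.toOp.conjTranspose := by
  cases g with
  | single q U => simp only [Gate.inv, Gate.toOp, onQubit_conjTranspose]; rfl
  | cnot c t h => simp only [Gate.inv, Gate.toOp, cnot_conjTranspose h]

theorem Gate.toOp_mul_conjTranspose (g : Gate ι) : g.toOp * g.toOp.conjTranspose = 1 := by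
  cases g with
  | single q U =>
    rw [Gate.toOp, onQubit_conjTranspose, ← onQubit_mul, ← Matrix.star_eq_conjTranspose,
      (Matrix.mem_unitaryGroup_iff).mp U.2, onQubit_one]
  | cnot c t h => rw [Gate.toOp, cnot_conjTranspose h, cnot_mul_self h]

theorem Circuit.toOp_inv (C : Circuit ι) : C.inv.toOp = C.toOp.conjTranspose := by
  induction C with
  | nil => simp [Circuit.inv, Circuit.toOp]
  | cons g C ih =>
    have : Circuit.inv (g :: C) = Circuit.inv C ++ [g.inv] := by simp [Circuit.inv]
    rw [this, toOp_append, ih, toOp_cons, toOp_nil, one_mul, toOp_cons,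
      Matrix.conjTranspose_mul, Gate.toOp_inv]

theorem Circuit.toOp_mul_conjTranspose (C : Circuit ι) : C.toOp * C.toOp.conjTranspose = 1 := by
  induction C with
  | nil => simp [Circuit.toOp]
  | cons g C ih =>
    rw [toOp_cons, Matrix.conjTranspose_mul, mul_assoc, ← mul_assoc g.toOp,
      Gate.toOp_mul_conjTranspose, one_mul, ih]

theorem Circuit.toOp_mem_unitary (C : Circuit ι) : C.toOp ∈ unitary (Op ι) := by
  have h := C.toOp_mul_conjTranspose
  exact ⟨mul_eq_one_comm.mp h, h⟩

end Circuits

/-! ### One-qubit gates -/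

section OneQubit

def pauliZ : Matrix (Fin 2) (Fin 2) ℂ := !![1, 0; 0, -1]

theorem sqrt_two_mul_self : ((Real.sqrt 2 : ℝ) : ℂ) * ((Real.sqrt 2 : ℝ) : ℂ) = 2 := by
  rw [← Complex.ofReal_mul, Real.mul_self_sqrt (by norm_num)]; norm_num

theorem sqrt_two_ne_zero : ((Real.sqrt 2 : ℝ) : ℂ) ≠ 0 := by
  simp

theorem hadamard_eq :
    hadamard = ((Real.sqrt 2 : ℝ) : ℂ)⁻¹ • (pauliX + pauliZ) := by
  rw [hadamard]; congr 1
  ext i j; fin_cases i <;> fin_cases j <;> simp [pauliX, pauliZ]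

theorem pauliZ_mul_self : pauliZ * pauliZ = 1 := by
  ext i j; fin_cases i <;> fin_cases j <;> simp [pauliZ, Matrix.mul_apply]

theorem pauliZ_mul_pauliX : pauliZ * pauliX = -(pauliX * pauliZ) := by
  ext i j; fin_cases i <;> fin_cases j <;> simp [pauliZ, pauliX, Matrix.mul_apply]

theorem hadamard_mul_self : hadamard * hadamard = 1 := by
  have : (pauliX + pauliZ) * (pauliX + pauliZ) = (2 : ℂ) • 1 := by
    rw [add_mul, mul_add, mul_add, pauliX_mul_self, pauliZ_mul_self, pauliZ_mul_pauliX, two_smul]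
    abel
  rw [hadamard_eq, smul_mul_smul_comm, this, smul_smul, ← mul_inv, sqrt_two_mul_self,
    inv_mul_cancel₀ two_ne_zero, one_smul]

theorem hadamard_mul_pauliX_mul_hadamard : hadamard * pauliX * hadamard = pauliZ := by
  have : (pauliX + pauliZ) * pauliX * (pauliX + pauliZ) = (2 : ℂ) • pauliZ := by
    have h1 : pauliX * pauliZ * pauliX = -pauliZ := by
      rw [mul_assoc, pauliZ_mul_pauliX, mul_neg, ← mul_assoc, pauliX_mul_self, one_mul]
    have h2 : pauliX * pauliZ * pauliZ = pauliX := by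
      rw [mul_assoc, pauliZ_mul_self, mul_one]
    rw [add_mul, pauliX_mul_self, pauliZ_mul_pauliX, add_mul, one_mul, neg_mul, mul_add, h1, h2,
      two_smul]
    abel
  rw [hadamard_eq, smul_mul_assoc, smul_mul_smul_comm, this, smul_smul, ← mul_inv,
    sqrt_two_mul_self, inv_mul_cancel₀ two_ne_zero, one_smul]

/-- `X` and the Hadamard gate are reflections whose axes enclose a fixed angle. Their scalar
anticommutator makes `(X + H)^2` the scalar `2 + √2`, so the normalised sum is a reflection
exchanging the two. -/
theorem hadamard_anticomm :
    hadamard * pauliX + pauliX * hadamard = ((Real.sqrt 2 : ℝ) : ℂ) • 1 := by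
  have : (pauliX + pauliZ) * pauliX + pauliX * (pauliX + pauliZ) = (2 : ℂ) • 1 := by
    rw [add_mul, mul_add, pauliX_mul_self, pauliZ_mul_pauliX, two_smul]
    abel
  rw [hadamard_eq, smul_mul_assoc, mul_smul_comm, ← smul_add, this, smul_smul]
  congr 1
  rw [← sqrt_two_mul_self, inv_mul_cancel_left₀ sqrt_two_ne_zero]

/-- The reflection that exchanges `X` and the Hadamard gate. -/
def bisector : Matrix (Fin 2) (Fin 2) ℂ :=
  ((Real.sqrt (2 + Real.sqrt 2) : ℝ) : ℂ)⁻¹ • (pauliX + hadamard)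

theorem bisector_const_mul_self :
    ((Real.sqrt (2 + Real.sqrt 2) : ℝ) : ℂ)⁻¹ * ((Real.sqrt (2 + Real.sqrt 2) : ℝ) : ℂ)⁻¹
      * (2 + ((Real.sqrt 2 : ℝ) : ℂ)) = 1 := by
  have h : (0 : ℝ) < 2 + Real.sqrt 2 := by positivity
  rw [← mul_inv, ← Complex.ofReal_mul, Real.mul_self_sqrt h.le, Complex.ofReal_add]
  refine inv_mul_cancel₀ ?_
  exact_mod_cast h.ne'

theorem bisector_mul_self : bisector * bisector = 1 := by
  have : (pauliX + hadamard) * (pauliX + hadamard) = (2 + ((Real.sqrt 2 : ℝ) : ℂ)) • 1 := by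
    rw [add_smul, ← hadamard_anticomm, add_mul, mul_add, mul_add, pauliX_mul_self,
      hadamard_mul_self, two_smul]
    abel
  rw [bisector, smul_mul_smul_comm, this, smul_smul, bisector_const_mul_self, one_smul]

theorem bisector_mul_pauliX_mul_bisector : bisector * pauliX * bisector = hadamard := by
  have : (pauliX + hadamard) * pauliX * (pauliX + hadamard)
      = (2 + ((Real.sqrt 2 : ℝ) : ℂ)) • hadamard := by
    have h1 : hadamard * pauliX * hadamard
        = ((Real.sqrt 2 : ℝ) : ℂ) • hadamard - pauliX := by
      rw [eq_sub_of_add_eq hadamard_anticomm, sub_mul, smul_mul_assoc, one_mul, mul_assoc,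
        hadamard_mul_self, mul_one]
    rw [add_mul, pauliX_mul_self, add_mul, one_mul, mul_add, h1, mul_assoc, pauliX_mul_self,
      mul_one, add_smul, two_smul]
    abel
  rw [bisector, smul_mul_assoc, smul_mul_smul_comm, this, smul_smul, bisector_const_mul_self,
    one_smul]

theorem pauliX_conjTranspose : pauliX.conjTranspose = pauliX := by
  ext i j; fin_cases i <;> fin_cases j <;> simp [pauliX]

theorem hadamard_conjTranspose : hadamard.conjTranspose = hadamard := by
  ext i j; fin_cases i <;> fin_cases j <;> simp [hadamard]

theorem bisector_conjTranspose : bisector.conjTranspose = bisector := by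
  rw [bisector, Matrix.conjTranspose_smul, Matrix.conjTranspose_add, pauliX_conjTranspose,
    hadamard_conjTranspose]
  congr 1
  rw [star_inv₀, Complex.star_def, Complex.conj_ofReal]

/-- A self-adjoint involution as a unitary. -/
def involution (A : Matrix (Fin 2) (Fin 2) ℂ) (h : A.conjTranspose = A) (h2 : A * A = 1) :
    Matrix.unitaryGroup (Fin 2) ℂ :=
  ⟨A, Matrix.mem_unitaryGroup_iff.mpr (by rw [Matrix.star_eq_conjTranspose, h, h2])⟩

def xGate : Matrix.unitaryGroup (Fin 2) ℂ := involution pauliX pauliX_conjTranspose pauliX_mul_self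

def hGate : Matrix.unitaryGroup (Fin 2) ℂ :=
  involution hadamard hadamard_conjTranspose hadamard_mul_self

def bisectorGate : Matrix.unitaryGroup (Fin 2) ℂ :=
  involution bisector bisector_conjTranspose bisector_mul_self

theorem rz_mul (θ φ : ℝ) : rz θ * rz φ = rz (θ + φ) := by
  ext i j
  fin_cases i <;> fin_cases j <;> simp [rz, Matrix.mul_apply, ← Complex.exp_add] <;> ring_nf

theorem rz_zero : rz 0 = 1 := by
  ext i j
  fin_cases i <;> fin_cases j <;> simp [rz]

theorem rz_conjTranspose (θ : ℝ) : (rz θ).conjTranspose = rz (-θ) := by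
  ext i j
  fin_cases i <;> fin_cases j <;>
    simp [rz, ← Complex.exp_conj, neg_div, Complex.conj_ofNat]

theorem pauliX_mul_rz_mul_pauliX (θ : ℝ) : pauliX * rz θ * pauliX = rz (-θ) := by
  ext i j
  fin_cases i <;> fin_cases j <;> simp [rz, pauliX, Matrix.mul_apply, neg_div]

def rzGate (θ : ℝ) : Matrix.unitaryGroup (Fin 2) ℂ :=
  ⟨rz θ, Matrix.mem_unitaryGroup_iff.mpr (by
    rw [Matrix.star_eq_conjTranspose, rz_conjTranspose, rz_mul, add_neg_cancel, rz_zero])⟩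

theorem phaseGate_conjTranspose (l : ℝ) : (phaseGate l).conjTranspose = phaseGate (-l) := by
  ext i j
  fin_cases i <;> fin_cases j <;>
    simp [phaseGate, ← Complex.exp_conj]

def phaseUnitary (l : ℝ) : Matrix.unitaryGroup (Fin 2) ℂ :=
  ⟨phaseGate l, Matrix.mem_unitaryGroup_iff.mpr (by
    rw [Matrix.star_eq_conjTranspose, phaseGate_conjTranspose]
    ext i j
    fin_cases i <;> fin_cases j <;> simp [phaseGate, Matrix.mul_apply, ← Complex.exp_add])⟩

end OneQubit

/-! ### Multi-controlled `X` from a ladder with borrowed qubits -/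

section Ladder

variable {ι : Type} [Fintype ι] [DecidableEq ι]

/-- The projection onto the states in which all qubits of the list are `1`. -/
def allOnes (l : List ι) : Op ι := (l.map fun q => onQubit q sigma11).prod

theorem allOnes_cons (q : ι) (l : List ι) :
    allOnes (q :: l) = onQubit q sigma11 * allOnes l := by simp [allOnes]

theorem allOnes_append (l l' : List ι) : allOnes (l ++ l') = allOnes l * allOnes l' := by
  simp [allOnes]

/-- The tensor form depends only on membership in the list, so the order of the controls becomes
irrelevant. -/
theorem allOnes_eq_tensor (l : List ι) :
    allOnes l = tensor fun k => if k ∈ l then sigma11 else 1 := by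
  induction l with
  | nil => simp [allOnes, tensor_one]
  | cons q l ih =>
    rw [allOnes_cons, ih, onQubit_mul_tensor]
    congr 1
    ext1 k
    by_cases h : k = q
    · subst h
      by_cases hk : k ∈ l <;> simp [hk, sigma11_mul_self]
    · simp [h]

theorem allOnes_mul_self (l : List ι) : allOnes l * allOnes l = allOnes l := by
  rw [allOnes_eq_tensor, tensor_mul]
  congr 1
  ext1 k
  split_ifs
  · exact sigma11_mul_self
  · exact mul_one _

theorem allOnes_mem_localAlg (l : List ι) : allOnes l ∈ localAlg {q : ι | q ∈ l} :=
  list_prod_mem (by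
    intro U hU
    obtain ⟨q, hq, rfl⟩ := List.mem_map.mp hU
    exact onQubit_mem_localAlg (S := {q : ι | q ∈ l}) hq _)

theorem allOnes_commute_onQubit {l : List ι} {q : ι} (h : q ∉ l)
    (A : Matrix (Fin 2) (Fin 2) ℂ) : Commute (allOnes l) (onQubit q A) :=
  localAlg_commute_onQubit (S := {q : ι | q ∈ l}) h (allOnes_mem_localAlg l) A

theorem sigma11_idem (c : ι) : onQubit c sigma11 * onQubit c sigma11 = onQubit c sigma11 := by
  rw [← onQubit_mul, sigma11_mul_self]

/-- The Hadamard gate on `a` if qubit `c` is `0`, with a single CNOT. -/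
def openCH (c a : ι) : Circuit ι :=
  [.single a bisectorGate] ++ cx c a ++ [.single a bisectorGate] ++ [.single a hGate]

/-- Since `u * v` is its own inverse, it equals `(u * v)⁻¹ = v * u`. -/
theorem commute_of_involutions {R : Type*} [Monoid R] {u v : R} (hu : u * u = 1) (hv : v * v = 1)
    (h : u * v * (u * v) = 1) : Commute u v :=
  calc u * v = u * v * (u * (v * v) * u) := by rw [hv, mul_one, hu, mul_one]
    _ = u * v * (u * v) * (v * u) := by simp only [mul_assoc]
    _ = v * u := by rw [h, one_mul]

omit [Fintype ι] in
theorem nonlocalCount_openCH {c a : ι} (h : c ≠ a) : (openCH c a).nonlocalCount = 1 := by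
  simp only [openCH, Circuit.nonlocalCount_append, nonlocalCount_cx h]
  rfl

theorem toOp_single (q : ι) (U : Matrix.unitaryGroup (Fin 2) ℂ) :
    Circuit.toOp [Gate.single q U] = onQubit q (U : Matrix (Fin 2) (Fin 2) ℂ) := by
  simp [Circuit.toOp, Gate.toOp]

/-- Conjugating the CNOT by the bisector gives a controlled Hadamard. The final uncontrolled
Hadamard cancels it when `c` is `1` and is all that remains when `c` is `0`. -/
theorem toOp_openCH {c a : ι} (h : c ≠ a) :
    (openCH c a).toOp = onQubit c sigma00 * onQubit a hadamard + onQubit c sigma11 := by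
  have hR : onQubit a bisector * onQubit a bisector = 1 := by
    rw [← onQubit_mul, bisector_mul_self, onQubit_one]
  have hH : onQubit a hadamard * onQubit a hadamard = 1 := by
    rw [← onQubit_mul, hadamard_mul_self, onQubit_one]
  have h1 : (openCH c a).toOp = onQubit a hadamard *
      (onQubit a bisector * cnot c a * onQubit a bisector) := by
    simp only [openCH, Circuit.toOp_append, toOp_single, toOp_cx h, mul_assoc]
    rfl
  rw [h1, cnot_eq_ctl h, ctl_conj (onQubit_commute h _ _) hR, ← onQubit_mul, ← onQubit_mul,
    bisector_mul_pauliX_mul_bisector, ctl, mul_add, ← mul_assoc,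
    (onQubit_commute h sigma11 hadamard).symm.eq, mul_assoc, hH, mul_one, sigma00_eq]
  congr 1
  rw [show onQubit c (1 - sigma11) = 1 - onQubit c sigma11 from
    (map_sub (onQubitHom c) _ _).trans (by rw [map_one]; rfl), mul_sub, sub_mul, mul_one, one_mul,
    (onQubit_commute h sigma11 hadamard).eq]

theorem sigma00_idem (c : ι) : onQubit c sigma00 * onQubit c sigma00 = onQubit c sigma00 := by
  rw [← onQubit_mul]
  congr 1
  ext i j; fin_cases i <;> fin_cases j <;> simp [sigma00, Matrix.mul_apply]

theorem sigma00_mul_sigma11 (c : ι) : onQubit c sigma00 * onQubit c sigma11 = 0 := by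
  rw [← onQubit_mul, show sigma00 * sigma11 = 0 by
    ext i j; fin_cases i <;> fin_cases j <;> simp [sigma00, sigma11, Matrix.mul_apply]]
  exact map_zero (onQubitHom c)

theorem sigma11_mul_sigma00 (c : ι) : onQubit c sigma11 * onQubit c sigma00 = 0 := by
  rw [← onQubit_mul, show sigma11 * sigma00 = 0 by
    ext i j; fin_cases i <;> fin_cases j <;> simp [sigma00, sigma11, Matrix.mul_apply]]
  exact map_zero (onQubitHom c)

theorem sigma00_add_sigma11 (c : ι) : onQubit c sigma00 + onQubit c sigma11 = 1 := by
  rw [← onQubit_add, sigma00_eq, sub_add_cancel, onQubit_one]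

/-- `A` on `a` if `c` is `0`, `B` on `a` if `c` is `1`. -/
def multiplexed (c a : ι) (A B : Matrix (Fin 2) (Fin 2) ℂ) : Op ι :=
  onQubit c sigma00 * onQubit a A + onQubit c sigma11 * onQubit a B

theorem multiplexed_mul {c a : ι} (h : c ≠ a) (A B A' B' : Matrix (Fin 2) (Fin 2) ℂ) :
    multiplexed c a A B * multiplexed c a A' B' = multiplexed c a (A * A') (B * B') := by
  have key : ∀ (s s' A A' : Matrix (Fin 2) (Fin 2) ℂ),
      onQubit c s * onQubit a A * (onQubit c s' * onQubit a A')
        = onQubit c s * onQubit c s' * onQubit a (A * A') := by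
    intro s s' A A'
    rw [mul_assoc, ← mul_assoc (onQubit a A), ← (onQubit_commute h s' A).eq, onQubit_mul]
    simp only [mul_assoc]
  simp only [multiplexed, add_mul, mul_add, key, sigma00_idem, sigma11_idem, sigma00_mul_sigma11,
    sigma11_mul_sigma00, zero_mul, add_zero, zero_add]

theorem multiplexed_const (c a : ι) (A : Matrix (Fin 2) (Fin 2) ℂ) :
    multiplexed c a A A = onQubit a A := by
  rw [multiplexed, ← add_mul, sigma00_add_sigma11, one_mul]

theorem multiplexed_mem {S : Set ι} {c a : ι} (hc : c ∈ S) (ha : a ∈ S)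
    (A B : Matrix (Fin 2) (Fin 2) ℂ) : multiplexed c a A B ∈ localAlg S :=
  add_mem (mul_mem (onQubit_mem_localAlg hc _) (onQubit_mem_localAlg ha _))
    (mul_mem (onQubit_mem_localAlg hc _) (onQubit_mem_localAlg ha _))

theorem toOp_openCH_eq {c a : ι} (h : c ≠ a) :
    (openCH c a).toOp = multiplexed c a hadamard 1 := by
  rw [toOp_openCH h, multiplexed, onQubit_one, mul_one]

/-- A bit flip on the control propagates to the target. A `Z` on the control does not, and this
difference drives the ladder. -/
theorem cnot_conj_pauliX {c t : ι} (h : c ≠ t) :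
    cnot c t * onQubit c pauliX * cnot c t = onQubit c pauliX * onQubit t pauliX := by
  have hX : onQubit c sigma00 * onQubit c pauliX = onQubit c pauliX * onQubit c sigma11 := by
    rw [← onQubit_mul, ← onQubit_mul]
    congr 1
    ext i j; fin_cases i <;> fin_cases j <;> simp [sigma00, sigma11, pauliX, Matrix.mul_apply]
  have hX' : onQubit c sigma11 * onQubit c pauliX = onQubit c pauliX * onQubit c sigma00 := by
    rw [← onQubit_mul, ← onQubit_mul]
    congr 1
    ext i j; fin_cases i <;> fin_cases j <;> simp [sigma00, sigma11, pauliX, Matrix.mul_apply]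
  have ht : onQubit t pauliX * onQubit t pauliX = 1 := by
    rw [← onQubit_mul, pauliX_mul_self, onQubit_one]
  have e : cnot c t * onQubit c pauliX = onQubit c pauliX *
      (onQubit c sigma11 + onQubit c sigma00 * onQubit t pauliX) := by
    rw [cnot_eq h, add_mul, hX, mul_assoc, ← (onQubit_commute h pauliX pauliX).eq, ← mul_assoc,
      hX', mul_add, mul_assoc]
  have f : (onQubit c sigma11 + onQubit c sigma00 * onQubit t pauliX) * cnot c t
      = onQubit t pauliX := by
    have key : multiplexed c t pauliX 1 * multiplexed c t 1 pauliX = onQubit t pauliX := by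
      rw [multiplexed_mul h, one_mul, mul_one, multiplexed_const]
    rw [multiplexed, multiplexed, onQubit_one, mul_one, mul_one] at key
    rw [cnot_eq h, add_comm (onQubit c sigma11), key]
  rw [e, mul_assoc, f]

theorem cnot_conj_pauliZ {c t : ι} (h : c ≠ t) :
    cnot c t * onQubit c pauliZ * cnot c t = onQubit c pauliZ := by
  have hZ : Commute (onQubit c sigma11) (onQubit c pauliZ) := by
    rw [Commute, SemiconjBy, ← onQubit_mul, ← onQubit_mul]
    congr 1
    ext i j; fin_cases i <;> fin_cases j <;> simp [sigma11, pauliZ, Matrix.mul_apply]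
  have : Commute (onQubit c pauliZ) (cnot c t) := by
    rw [cnot_eq_ctl h]
    exact ctl_commute hZ.symm (onQubit_commute h _ _)
  rw [mul_assoc, this.eq, ← mul_assoc, cnot_mul_self h, one_mul]

/-- The CNOT copies a flip of `a` onto `t` but passes through `Z`. As `a` is flipped exactly in the
branch where `c` is `1`, an `X` on `t` controlled by `c` is produced. -/
theorem cnot_conj_multiplexed {c a t : ι} (hca : c ≠ a) (hct : c ≠ t) (hat : a ≠ t) :
    cnot a t * multiplexed c a pauliZ pauliX * cnot a t
      = multiplexed c a pauliZ pauliX * ctl (onQubit c sigma11) (onQubit t pauliX) := by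
  have hc : ∀ s, cnot a t * onQubit c s = onQubit c s * cnot a t := fun s =>
    (localAlg_commute_onQubit (S := {a, t}) (by simp [hca, hct])
      (cnot_mem_localAlg hat (by simp) (by simp)) s).eq
  have key : ∀ s A, cnot a t * (onQubit c s * onQubit a A) * cnot a t
      = onQubit c s * (cnot a t * onQubit a A * cnot a t) := by
    intro s A
    rw [← mul_assoc, hc]
    simp only [mul_assoc]
  have h0 : ∀ A, onQubit c sigma00 * onQubit a A * ctl (onQubit c sigma11) (onQubit t pauliX)
      = onQubit c sigma00 * onQubit a A := by
    intro A
    have : onQubit c sigma00 * onQubit a A * onQubit c sigma11 = 0 := by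
      rw [mul_assoc, ← (onQubit_commute hca sigma11 A).eq, ← mul_assoc, sigma00_mul_sigma11,
        zero_mul]
    rw [ctl, mul_add, mul_sub, mul_one, ← mul_assoc, this, zero_mul, sub_zero, add_zero]
  have h1 : ∀ A, onQubit c sigma11 * onQubit a A * ctl (onQubit c sigma11) (onQubit t pauliX)
      = onQubit c sigma11 * (onQubit a A * onQubit t pauliX) := by
    intro A
    have : onQubit c sigma11 * onQubit a A * onQubit c sigma11
        = onQubit c sigma11 * onQubit a A := by
      rw [mul_assoc, ← (onQubit_commute hca sigma11 A).eq, ← mul_assoc, sigma11_idem]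
    rw [ctl, mul_add, mul_sub, mul_one, ← mul_assoc, this, sub_self, zero_add, mul_assoc]
  rw [multiplexed, mul_add, add_mul, key, key, cnot_conj_pauliX hat, cnot_conj_pauliZ hat, add_mul,
    h0, h1]

/-- A cascade of CNOTs conjugated by open controlled Hadamard gates; the last pair of the list
forms the innermost level. -/
def ladder (c₀ : ι) : List (ι × ι) → Circuit ι
  | [] => []
  | [(c, a)] => openCH c a ++ cx c₀ a ++ openCH c a
  | (c, a) :: (c', a') :: l =>
      openCH c a ++ cx a' a ++ ladder c₀ ((c', a') :: l) ++ cx a' a ++ openCH c a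

/-- The qubits of a ladder. -/
def ladderQubits (c₀ : ι) (l : List (ι × ι)) : List ι :=
  l.flatMap (fun p => [p.1, p.2]) ++ [c₀]

/-- The controls of a ladder. -/
def ladderControls (c₀ : ι) (l : List (ι × ι)) : List ι := l.map Prod.fst ++ [c₀]

omit [Fintype ι] [DecidableEq ι] in
theorem ladderControls_subset (c₀ : ι) (l : List (ι × ι)) :
    ∀ q ∈ ladderControls c₀ l, q ∈ ladderQubits c₀ l := by
  intro q hq
  simp only [ladderControls, ladderQubits, List.mem_append, List.mem_map, List.mem_flatMap,
    List.mem_singleton] at hq ⊢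
  rcases hq with ⟨p, hp, rfl⟩ | rfl
  · exact Or.inl ⟨p, hp, by simp⟩
  · exact Or.inr rfl

/-- What a ladder does: it is an involution, and conjugation by a CNOT controlled by its top
ancilla `a` extends it by an `X` gate controlled by all controls of the ladder. -/
structure LadderSpec (S : Set ι) (a : ι) (P L : Op ι) : Prop where
  mem : L ∈ localAlg S
  invol : L * L = 1
  conj : ∀ t ∉ S, cnot a t * L * cnot a t = L * ctl P (onQubit t pauliX)

/-- Here `K` is the next inner ladder conjugated by the CNOT onto `a`, or the innermost CNOT itself.
The open Hadamards commute with `L'` and `P` and turn the `X` on `a` into `Z` or `X` according to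
`c`. Conjugation by the CNOT from `a` to `t` then adds a flip of `t` controlled by both `c` and `P`.
The result is an involution because it is a conjugate of `K`. -/
theorem ladderSpec_step {S : Set ι} {c a : ι} {P L' K : Op ι} (hca : c ≠ a)
    (hc : c ∉ S) (ha : a ∉ S)
    (hP : P ∈ localAlg S) (hPP : P * P = P) (hL' : L' ∈ localAlg S)
    (hK : K = L' * ctl P (onQubit a pauliX)) (hKK : K * K = 1) :
    LadderSpec (insert c (insert a S)) a (onQubit c sigma11 * P)
      (multiplexed c a hadamard 1 * K * multiplexed c a hadamard 1) := by
  have hA : multiplexed c a hadamard 1 * multiplexed c a hadamard 1 = 1 := by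
    rw [multiplexed_mul hca, hadamard_mul_self, one_mul, multiplexed_const, onQubit_one]
  have hAm : multiplexed c a hadamard 1 ∈ localAlg ({c, a} : Set ι) :=
    multiplexed_mem (by simp) (by simp) _ _
  have hMm : multiplexed c a pauliZ pauliX ∈ localAlg ({c, a} : Set ι) :=
    multiplexed_mem (by simp) (by simp) _ _
  have hd : Disjoint S ({c, a} : Set ι) := by
    rw [Set.disjoint_right]
    rintro x (rfl | rfl)
    exacts [hc, ha]
  have hAX : multiplexed c a hadamard 1 * onQubit a pauliX * multiplexed c a hadamard 1
      = multiplexed c a pauliZ pauliX := by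
    rw [← multiplexed_const c a pauliX, multiplexed_mul hca, multiplexed_mul hca,
      hadamard_mul_pauliX_mul_hadamard, one_mul, mul_one]
  have hL : multiplexed c a hadamard 1 * K * multiplexed c a hadamard 1
      = L' * ctl P (multiplexed c a pauliZ pauliX) := by
    rw [hK, ← mul_assoc, ← (localAlg_commute hd hL' hAm).eq, mul_assoc L', mul_assoc L',
      ctl_conj (localAlg_commute hd hP hAm) hA, hAX]
  refine ⟨?_, ?_, ?_⟩
  · rw [hL]
    have hsub : S ⊆ insert c (insert a S) := fun x hx => by simp [hx]
    exact mul_mem (localAlg_mono hsub hL')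
      (add_mem (sub_mem (one_mem _) (localAlg_mono hsub hP))
        (mul_mem (localAlg_mono hsub hP) (multiplexed_mem (by simp) (by simp) _ _)))
  · calc _ = multiplexed c a hadamard 1 * K *
          (multiplexed c a hadamard 1 * multiplexed c a hadamard 1) * K
          * multiplexed c a hadamard 1 := by simp only [mul_assoc]
      _ = 1 := by rw [hA, mul_one, mul_assoc _ K K, hKK, mul_one, hA]
  · intro t ht
    have htc : c ≠ t := fun e => ht (by simp [e])
    have hta : a ≠ t := fun e => ht (by simp [e])
    have htS : t ∉ S := fun e => ht (by simp [e])
    have hd' : Disjoint S ({a, t} : Set ι) := by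
      rw [Set.disjoint_right]
      rintro x (rfl | rfl)
      exacts [ha, htS]
    have hcx : cnot a t ∈ localAlg ({a, t} : Set ι) := cnot_mem_localAlg hta (by simp) (by simp)
    rw [hL, ← mul_assoc, ← (localAlg_commute hd' hL' hcx).eq, mul_assoc L', mul_assoc L',
      ctl_conj (localAlg_commute hd' hP hcx) (cnot_mul_self hta),
      cnot_conj_multiplexed hca htc hta, ← ctl_mul hPP (localAlg_commute hd hP hMm), ctl_ctl,
      mul_assoc, (localAlg_commute_onQubit hc hP sigma11).eq]

theorem ladder_spec (c₀ : ι) : ∀ (l : List (ι × ι)) (c a : ι),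
    (ladderQubits c₀ ((c, a) :: l)).Nodup →
    LadderSpec {q : ι | q ∈ ladderQubits c₀ ((c, a) :: l)} a (allOnes (ladderControls c₀ ((c, a) :: l)))
      (ladder c₀ ((c, a) :: l)).toOp
  | [], c, a, h => by
    simp only [ladderQubits, List.flatMap_cons, List.flatMap_nil, List.cons_append, List.nil_append,
      List.append_nil, List.nodup_cons, List.mem_cons, List.not_mem_nil, or_false, not_or] at h
    obtain ⟨⟨hca, hcc⟩, hac, -⟩ := h
    have hL : (ladder c₀ [(c, a)]).toOp
        = multiplexed c a hadamard 1 * cnot c₀ a * multiplexed c a hadamard 1 := by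
      simp only [ladder, Circuit.toOp_append, toOp_openCH_eq hca, toOp_cx (Ne.symm hac), mul_assoc]
    have h0 : onQubit c₀ sigma11 ∈ localAlg ({c₀} : Set ι) := onQubit_mem_localAlg (by simp) _
    -- At the innermost level there is no inner ladder: `L' = 1`, and `K` is the plain CNOT from
    -- `c₀`.
    have hs := ladderSpec_step (S := {c₀}) (L' := 1) hca (by simpa using hcc) (by simpa using hac)
      h0 (sigma11_idem c₀) (one_mem _) ((one_mul _).symm) (by
        rw [← cnot_eq_ctl (Ne.symm hac), cnot_mul_self (Ne.symm hac)])
    rw [hL, cnot_eq_ctl (Ne.symm hac)]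
    have hP : allOnes (ladderControls c₀ [(c, a)]) = onQubit c sigma11 * onQubit c₀ sigma11 := by
      simp [allOnes, ladderControls]
    have hS : {q : ι | q ∈ ladderQubits c₀ [(c, a)]} = insert c (insert a ({c₀} : Set ι)) := by
      ext q; simp [ladderQubits]
    rw [hP, hS]
    exact hs
  | (c', a') :: l, c, a, h => by
    have hq : ladderQubits c₀ ((c, a) :: (c', a') :: l)
        = c :: a :: ladderQubits c₀ ((c', a') :: l) := by simp [ladderQubits]
    rw [hq] at h ⊢
    simp only [List.nodup_cons, List.mem_cons, not_or] at h
    obtain ⟨⟨hca, hc⟩, ha, hnd⟩ := h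
    have ih := ladder_spec c₀ l c' a' hnd
    have ha' : a' ≠ a := fun e => ha (by simp [ladderQubits, e])
    have hL : (ladder c₀ ((c, a) :: (c', a') :: l)).toOp = multiplexed c a hadamard 1 *
        (cnot a' a * (ladder c₀ ((c', a') :: l)).toOp * cnot a' a) *
        multiplexed c a hadamard 1 := by
      simp only [ladder, Circuit.toOp_append, toOp_openCH_eq hca, toOp_cx ha', mul_assoc]
    have hP : allOnes (ladderControls c₀ ((c, a) :: (c', a') :: l))
        = onQubit c sigma11 * allOnes (ladderControls c₀ ((c', a') :: l)) := by
      simp only [ladderControls, List.map_cons, List.cons_append, allOnes_cons]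
    have hS : {q : ι | q ∈ c :: a :: ladderQubits c₀ ((c', a') :: l)}
        = insert c (insert a {q | q ∈ ladderQubits c₀ ((c', a') :: l)}) := by
      ext q; simp
    rw [hL, hP, hS]
    refine ladderSpec_step hca hc ha
      (localAlg_mono (ladderControls_subset c₀ _) (allOnes_mem_localAlg _)) (allOnes_mul_self _)
      ih.mem (ih.conj a ha) ?_
    calc _ = cnot a' a * (ladder c₀ ((c', a') :: l)).toOp * (cnot a' a * cnot a' a)
          * (ladder c₀ ((c', a') :: l)).toOp * cnot a' a := by simp only [mul_assoc]
      _ = 1 := by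
        rw [cnot_mul_self ha', mul_one, mul_assoc (cnot a' a), ih.invol, mul_one, cnot_mul_self ha']

omit [Fintype ι] in
-- The innermost level has two open Hadamards and one CNOT; each further level adds two of both.
theorem nonlocalCount_ladder (c₀ : ι) : ∀ (l : List (ι × ι)) (c a : ι),
    (ladderQubits c₀ ((c, a) :: l)).Nodup →
    (ladder c₀ ((c, a) :: l)).nonlocalCount = 4 * l.length + 3
  | [], c, a, h => by
    simp only [ladderQubits, List.flatMap_cons, List.flatMap_nil, List.cons_append, List.nil_append,
      List.append_nil, List.nodup_cons, List.mem_cons, List.not_mem_nil, or_false, not_or] at h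
    obtain ⟨⟨hca, hcc⟩, hac, -⟩ := h
    simp [ladder, Circuit.nonlocalCount_append, nonlocalCount_openCH hca,
      nonlocalCount_cx (Ne.symm hac)]
  | (c', a') :: l, c, a, h => by
    have hq : ladderQubits c₀ ((c, a) :: (c', a') :: l)
        = c :: a :: ladderQubits c₀ ((c', a') :: l) := by simp [ladderQubits]
    rw [hq] at h
    simp only [List.nodup_cons, List.mem_cons, not_or] at h
    obtain ⟨⟨hca, hc⟩, ha, hnd⟩ := h
    have ha' : a' ≠ a := fun e => ha (by simp [ladderQubits, e])
    simp only [ladder, Circuit.nonlocalCount_append, nonlocalCount_openCH hca,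
      nonlocalCount_cx ha', nonlocalCount_ladder c₀ l c' a' hnd, List.length_cons]
    ring

/-- The multi-controlled `X` gate on `t`, controlled by `c₀` and the first components of the list,
with the second components as borrowed qubits. -/
def mcxLadder (c₀ : ι) (l : List (ι × ι)) (t : ι) : Circuit ι :=
  match l with
  | [] => cx c₀ t
  | (c, a) :: l => ladder c₀ ((c, a) :: l) ++ cx a t ++ ladder c₀ ((c, a) :: l) ++ cx a t

/-- With `L` the ladder and `G` the desired gate, the circuit is `(CNOT L CNOT) L = L G L`. Since `L
G` is conjugate to the involution `L`, it is an involution, so `L` commutes with `G` and cancels.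
The borrowed qubits are thus restored whatever their state. -/
theorem toOp_mcxLadder (c₀ : ι) (l : List (ι × ι)) (t : ι) (h : (t :: ladderQubits c₀ l).Nodup) :
    (mcxLadder c₀ l t).toOp = ctl (allOnes (ladderControls c₀ l)) (onQubit t pauliX) := by
  rw [List.nodup_cons] at h
  obtain ⟨ht, hnd⟩ := h
  cases l with
  | nil =>
    have : c₀ ≠ t := fun e => ht (by simp [ladderQubits, e])
    simp [mcxLadder, toOp_cx this, cnot_eq_ctl this, ladderControls, allOnes]
  | cons p l =>
    obtain ⟨c, a⟩ := p
    have hat : a ≠ t := fun e => ht (by simp [ladderQubits, e])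
    have hs := ladder_spec c₀ l c a hnd
    have hcomm : Commute (ladder c₀ ((c, a) :: l)).toOp
        (ctl (allOnes (ladderControls c₀ ((c, a) :: l))) (onQubit t pauliX)) := by
      have e := hs.conj t ht
      have hLinv : (cnot a t * (ladder c₀ ((c, a) :: l)).toOp * cnot a t) *
          (cnot a t * (ladder c₀ ((c, a) :: l)).toOp * cnot a t) = 1 := by
        calc _ = cnot a t * (ladder c₀ ((c, a) :: l)).toOp * (cnot a t * cnot a t)
              * (ladder c₀ ((c, a) :: l)).toOp * cnot a t := by simp only [mul_assoc]
          _ = 1 := by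
            rw [cnot_mul_self hat, mul_one, mul_assoc (cnot a t), hs.invol, mul_one,
              cnot_mul_self hat]
      have hctl : ctl (allOnes (ladderControls c₀ ((c, a) :: l))) (onQubit t pauliX) *
          ctl (allOnes (ladderControls c₀ ((c, a) :: l))) (onQubit t pauliX) = 1 := by
        rw [ctl_mul (allOnes_mul_self _) (localAlg_commute_onQubit
          (S := {q : ι | q ∈ ladderQubits c₀ ((c, a) :: l)}) ht
          (localAlg_mono (ladderControls_subset c₀ _) (allOnes_mem_localAlg _)) _),
          ← onQubit_mul, pauliX_mul_self, onQubit_one, ctl_one]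
      rw [e] at hLinv
      exact commute_of_involutions hs.invol hctl hLinv
    simp only [mcxLadder, Circuit.toOp_append, toOp_cx hat]
    rw [← mul_assoc, ← mul_assoc, hs.conj t ht, hcomm.eq, mul_assoc, hs.invol, mul_one]

omit [Fintype ι] in
theorem nonlocalCount_mcxLadder (c₀ : ι) (l : List (ι × ι)) (t : ι)
    (h : (t :: ladderQubits c₀ l).Nodup) :
    (mcxLadder c₀ l t).nonlocalCount = if l = [] then 1 else 8 * l.length := by
  rw [List.nodup_cons] at h
  obtain ⟨ht, hnd⟩ := h
  cases l with
  | nil =>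
    have : c₀ ≠ t := fun e => ht (by simp [ladderQubits, e])
    simp [mcxLadder, nonlocalCount_cx this]
  | cons p l =>
    obtain ⟨c, a⟩ := p
    have hat : a ≠ t := fun e => ht (by simp [ladderQubits, e])
    simp only [mcxLadder, Circuit.nonlocalCount_append, nonlocalCount_cx hat,
      nonlocalCount_ladder c₀ l c a hnd, List.length_cons, reduceCtorEq, if_false]
    ring

end Ladder

/-! ### Multi-controlled `X` and `RZ` gates -/

section MultiControlled

variable {ι : Type}

/-- Serves to transfer distinctness of the qubits from the two lists to the ladder; `zip` may drop
surplus borrowed qubits, hence only a subpermutation. -/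
theorem flatMap_zip_subperm (cs as : List ι) :
    ((cs.zip as).flatMap (fun p => [p.1, p.2])).Subperm (cs ++ as) := by
  induction cs generalizing as with
  | nil => simp
  | cons c cs ih =>
    cases as with
    | nil => simp
    | cons a as =>
      simp only [List.zip_cons_cons, List.flatMap_cons, List.cons_append, List.nil_append]
      refine List.Subperm.trans ?_ (List.Perm.subperm (List.Perm.cons c List.perm_middle.symm))
      exact (List.subperm_cons c).mpr ((List.subperm_cons a).mpr (ih as))

theorem nodup_ladderQubits_zip {t c₀ : ι} {cs as : List ι}
    (h : (t :: (c₀ :: cs ++ as)).Nodup) : (t :: ladderQubits c₀ (cs.zip as)).Nodup := by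
  have hs : (t :: ladderQubits c₀ (cs.zip as)).Subperm (t :: (c₀ :: cs ++ as)) := by
    refine (List.subperm_cons t).mpr ?_
    refine List.Subperm.trans (List.perm_append_comm.subperm) ?_
    exact (List.subperm_cons c₀).mpr (flatMap_zip_subperm cs as)
  obtain ⟨l, hp, hl⟩ := hs
  exact hp.nodup_iff.mp (hl.nodup h)

variable [DecidableEq ι]

/-- The multi-controlled `X` gate with controls `cs` and target `t`, which borrows the
qubits `as`. -/
def mcx (cs as : List ι) (t : ι) : Circuit ι :=
  match cs with
  | [] => [.single t xGate]
  | c₀ :: cs => mcxLadder c₀ (cs.zip as) t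

/-- The number of CNOTs of a multi-controlled `X` gate with `k` controls. -/
def mcxCount (k : ℕ) : ℕ := if k = 1 then 1 else 8 * (k - 1)

theorem nonlocalCount_mcx {cs as : List ι} {t : ι} (h : (t :: (cs ++ as)).Nodup)
    (hl : cs.length ≤ as.length + 1) : (mcx cs as t).nonlocalCount = mcxCount cs.length := by
  cases cs with
  -- Without controls the gate is a one-qubit `X`, and truncated subtraction gives `8 * (0 - 1) =
  -- 0`.
  | nil => rfl
  | cons c₀ cs =>
    rw [mcx, nonlocalCount_mcxLadder _ _ _ (nodup_ladderQubits_zip h), mcxCount]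
    -- The first control needs no borrowed partner, so one borrowed qubit fewer than controls keeps
    -- `zip` from dropping a control.
    have hz : (cs.zip as).length = cs.length := by
      simp only [List.length_cons] at hl
      rw [List.length_zip]; omega
    simp only [← List.length_eq_zero_iff, hz, List.length_cons, Nat.add_eq_right,
      Nat.add_sub_cancel]

/-- The rotation `rz (4 * φ)` of `t` controlled by all qubits of `cs` and `as`. -/
def mcrzCircuit (cs as : List ι) (t : ι) (φ : ℝ) : Circuit ι :=
  [.single t (rzGate φ)] ++ mcx as cs t ++ [.single t (rzGate (-φ))] ++ mcx cs as t ++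
    [.single t (rzGate φ)] ++ mcx as cs t ++ [.single t (rzGate (-φ))] ++ mcx cs as t

theorem nonlocalCount_mcrzCircuit {cs as : List ι} {t : ι} (φ : ℝ) (h : (t :: (cs ++ as)).Nodup)
    (hl : cs.length ≤ as.length + 1) (hl' : as.length ≤ cs.length + 1) :
    (mcrzCircuit cs as t φ).nonlocalCount = 2 * mcxCount cs.length + 2 * mcxCount as.length := by
  have h' : (t :: (as ++ cs)).Nodup := (List.Perm.cons t List.perm_append_comm).nodup_iff.mp h
  have h1 : ∀ U, Circuit.nonlocalCount [Gate.single t U] = 0 := fun U => rfl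
  simp only [mcrzCircuit, Circuit.nonlocalCount_append, h1, nonlocalCount_mcx h hl,
    nonlocalCount_mcx h' hl']
  ring

variable [Fintype ι]

theorem toOp_mcx {cs as : List ι} {t : ι} (h : (t :: (cs ++ as)).Nodup)
    (hl : cs.length ≤ as.length + 1) :
    (mcx cs as t).toOp = ctl (allOnes cs) (onQubit t pauliX) := by
  cases cs with
  | nil =>
    rw [mcx, toOp_single, show allOnes ([] : List ι) = 1 from rfl, ctl_one_left]
    rfl
  | cons c₀ cs =>
    rw [mcx, toOp_mcxLadder _ _ _ (nodup_ladderQubits_zip h), ladderControls, List.map_fst_zip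
      (by simpa using hl), allOnes_eq_tensor, allOnes_eq_tensor]
    simp [or_comm]

/-- A group commutator of two controlled reflections, `X` controlled by `cs` and `Z` controlled by
`as`. If either set of controls fails, the other reflection occurs twice and cancels. If both hold,
`X Z X Z` is a product of reflections, equal to the square of `rz (2 * φ)`. -/
theorem toOp_mcrzCircuit {cs as : List ι} {t : ι} (φ : ℝ) (h : (t :: (cs ++ as)).Nodup)
    (hl : cs.length ≤ as.length + 1) (hl' : as.length ≤ cs.length + 1) :
    (mcrzCircuit cs as t φ).toOp = ctl (allOnes (cs ++ as)) (onQubit t (rz (4 * φ))) := by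
  have h' : (t :: (as ++ cs)).Nodup := (List.Perm.cons t List.perm_append_comm).nodup_iff.mp h
  have hcs : t ∉ cs := fun e => (List.nodup_cons.mp h).1 (List.mem_append_left _ e)
  have has : t ∉ as := fun e => (List.nodup_cons.mp h).1 (List.mem_append_right _ e)
  have hR : onQubit t (rz (-φ)) * onQubit t (rz φ) = 1 := by
    rw [← onQubit_mul, rz_mul, neg_add_cancel, rz_zero, onQubit_one]
  have hX : onQubit t pauliX * onQubit t pauliX = 1 := by
    rw [← onQubit_mul, pauliX_mul_self, onQubit_one]
  have hXR : pauliX * rz (-φ) * pauliX * rz φ = rz (2 * φ) := by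
    rw [pauliX_mul_rz_mul_pauliX, rz_mul]; congr 1; ring
  set Z : Matrix (Fin 2) (Fin 2) ℂ := rz (-φ) * pauliX * rz φ with hZ
  have hZZ : Z * Z = 1 := by
    have : rz φ * rz (-φ) = 1 := by rw [rz_mul, add_neg_cancel, rz_zero]
    calc Z * Z = rz (-φ) * pauliX * (rz φ * rz (-φ)) * pauliX * rz φ := by
          simp only [hZ, mul_assoc]
      _ = 1 := by
          rw [this, mul_one, mul_assoc (rz (-φ)), pauliX_mul_self, mul_one, rz_mul,
            neg_add_cancel, rz_zero]
  have hXZ : pauliX * Z * pauliX * Z = rz (4 * φ) := by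
    calc pauliX * Z * pauliX * Z
        = (pauliX * rz (-φ) * pauliX * rz φ) * (pauliX * rz (-φ) * pauliX * rz φ) := by
          simp only [hZ, mul_assoc]
      _ = rz (4 * φ) := by rw [hXR, rz_mul]; congr 1; ring
  have hY : onQubit t (rz (-φ)) * ctl (allOnes as) (onQubit t pauliX) * onQubit t (rz φ)
      = ctl (allOnes as) (onQubit t Z) := by
    rw [ctl_conj (allOnes_commute_onQubit has _) hR, ← onQubit_mul, ← onQubit_mul]
  have hYY : ctl (allOnes as) (onQubit t Z) * ctl (allOnes as) (onQubit t Z) = 1 := by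
    rw [ctl_mul (allOnes_mul_self _) (allOnes_commute_onQubit has _), ← onQubit_mul, hZZ,
      onQubit_one, ctl_one]
  have hPY : Commute (allOnes cs) (ctl (allOnes as) (onQubit t Z)) := by
    refine ctl_commute ?_ (allOnes_commute_onQubit hcs _)
    rw [Commute, SemiconjBy, ← allOnes_append, ← allOnes_append, allOnes_eq_tensor,
      allOnes_eq_tensor]
    simp [or_comm]
  have e : (mcrzCircuit cs as t φ).toOp = ctl (allOnes cs) (onQubit t pauliX) *
      (onQubit t (rz (-φ)) * ctl (allOnes as) (onQubit t pauliX) * onQubit t (rz φ)) *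
      ctl (allOnes cs) (onQubit t pauliX) *
      (onQubit t (rz (-φ)) * ctl (allOnes as) (onQubit t pauliX) * onQubit t (rz φ)) := by
    simp only [mcrzCircuit, Circuit.toOp_append, toOp_single, toOp_mcx h hl, toOp_mcx h' hl',
      mul_assoc]
    rfl
  rw [e, hY, ctl_commutator (allOnes_mul_self _) (allOnes_commute_onQubit hcs _) hPY hYY,
    ctl_conj (allOnes_commute_onQubit has _) hX, ctl_mul (allOnes_mul_self _)
      ((allOnes_commute_onQubit has _).mul_right (allOnes_commute_onQubit has _) |>.mul_right
        (allOnes_commute_onQubit has _)), ctl_ctl,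
    ← onQubit_mul, ← onQubit_mul, ← onQubit_mul, hXZ, ← allOnes_append]

end MultiControlled

/-! ### Circuit and CNOT count of one second-order step on a register -/

section StepCircuit

variable {n : ℕ}

/-- The qubits below `j`. -/
def below (j : Fin n) : List (Fin n) := (List.finRange n).filter (fun m => m < j)

theorem mem_below {j m : Fin n} : m ∈ below j ↔ m < j := by simp [below]

theorem nodup_below (j : Fin n) : (below j).Nodup := (List.nodup_finRange n).filter _

theorem length_below (j : Fin n) : (below j).length = j := by
  rw [← List.toFinset_card_of_nodup (nodup_below j), ← Fin.card_Iio j]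
  congr 1
  ext m
  simp [mem_below]

theorem mcrz_eq_ctl (j : Fin n) (θ : ℝ) :
    mcrz j θ = ctl (allOnes (below j)) (onQubit j (rz θ)) := by
  have h : j ∉ below j := by simp [mem_below]
  rw [ctl, (allOnes_commute_onQubit h _).eq, allOnes_eq_tensor, onQubit_mul_tensor, mcrz, add_comm]
  simp only [mem_below]
  congr 2
  ext1 k
  by_cases hk : k = j
  · subst hk; simp
  · simp [hk]

def bellCircuit (j : Fin n) (lam : ℝ) : Circuit (Fin n) :=
  [.single j hGate] ++ [.single j (phaseUnitary lam)] ++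
    ((below j).map (fun m => cx j m)).reverse.flatten

theorem toOp_bellCircuit (j : Fin n) (lam : ℝ) : (bellCircuit j lam).toOp = bellU j lam := by
  have : ((below j).map (fun m => cx j m)).map Circuit.toOp
      = (below j).map (fun m => cnot j m) := by
    rw [List.map_map]
    exact List.map_congr_left fun m hm => toOp_cx (mem_below.mp hm).ne'
  rw [bellCircuit, Circuit.toOp_append, Circuit.toOp_append, Circuit.toOp_flatten, toOp_single,
    toOp_single, List.map_reverse, List.reverse_reverse, this, bellU, mul_assoc]
  rfl

theorem nonlocalCount_bellCircuit (j : Fin n) (lam : ℝ) :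
    (bellCircuit j lam).nonlocalCount = j := by
  have : ((below j).map (fun m => cx j m)).map Circuit.nonlocalCount
      = List.replicate j 1 := by
    rw [List.map_map, ← length_below j, ← List.map_const']
    exact List.map_congr_left fun m hm => nonlocalCount_cx (mem_below.mp hm).ne'
  have h1 : ∀ U, Circuit.nonlocalCount [Gate.single j U] = 0 := fun U => rfl
  rw [bellCircuit, Circuit.nonlocalCount_append, Circuit.nonlocalCount_append, h1, h1,
    Circuit.nonlocalCount_flatten, List.map_reverse, List.sum_reverse, this]
  simp

/-- The circuit for `W j θ lam`; the controls of the rotation are split into two halves, each of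
which is borrowed by the multi-controlled `X` gates of the other. -/
def wCircuit (j : Fin n) (θ lam : ℝ) : Circuit (Fin n) :=
  (bellCircuit j (-lam)).inv ++
    mcrzCircuit ((below j).take ((j + 1) / 2)) ((below j).drop ((j + 1) / 2)) j (θ / 2) ++
    bellCircuit j (-lam)

/-- Halves rounded up and down differ in length by at most one, so each contains enough borrowed
qubits for the other. -/
theorem toOp_wCircuit (j : Fin n) (θ lam : ℝ) : (wCircuit j θ lam).toOp = W j θ lam := by
  rw [wCircuit, Circuit.toOp_append, Circuit.toOp_append, Circuit.toOp_inv, toOp_bellCircuit,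
    toOp_mcrzCircuit, List.take_append_drop, W, mcrz_eq_ctl, ← mul_assoc,
    show 4 * (θ / 2) = 2 * θ by ring]
  · rw [List.take_append_drop, List.nodup_cons]
    exact ⟨by simp [mem_below], nodup_below j⟩
  · rw [List.length_take, List.length_drop, length_below]; omega
  · rw [List.length_take, List.length_drop, length_below]; omega

/-- The number of CNOTs of `wCircuit` with `k` controls. -/
def wCount (k : ℕ) : ℕ := 2 * k + (2 * mcxCount ((k + 1) / 2) + 2 * mcxCount (k - (k + 1) / 2))

theorem nonlocalCount_wCircuit (j : Fin n) (θ lam : ℝ) :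
    (wCircuit j θ lam).nonlocalCount = wCount j := by
  rw [wCircuit, Circuit.nonlocalCount_append, Circuit.nonlocalCount_append,
    Circuit.nonlocalCount_inv, nonlocalCount_bellCircuit, nonlocalCount_mcrzCircuit,
    List.length_take, List.length_drop, length_below, wCount, min_eq_left (by omega)]
  · ring
  · rw [List.take_append_drop, List.nodup_cons]
    exact ⟨by simp [mem_below], nodup_below j⟩
  · rw [List.length_take, List.length_drop, length_below]; omega
  · rw [List.length_take, List.length_drop, length_below]; omega

/-- If both halves have at least two controls, the count is `2 * k + 16 * (k - 2) = 18 * k - 32`;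
the constant 32 also covers the small exceptional cases. -/
theorem wCount_bounds (k : ℕ) : wCount k ≤ 18 * k ∧ 18 * k ≤ wCount k + 32 := by
  unfold wCount mcxCount
  split_ifs <;> omega

/-- The circuit for `V2 hn θ lam`. -/
def v2Circuit (hn : 0 < n) (θ lam : ℝ) : Circuit (Fin n) :=
  wCircuit ⟨0, hn⟩ (-θ / 2) lam ++ ((List.finRange n).map fun j => wCircuit j θ lam).flatten ++
    wCircuit ⟨0, hn⟩ (θ / 2) lam

theorem toOp_v2Circuit (hn : 0 < n) (θ lam : ℝ) : (v2Circuit hn θ lam).toOp = V2 hn θ lam := by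
  rw [v2Circuit, Circuit.toOp_append, Circuit.toOp_append, Circuit.toOp_flatten, toOp_wCircuit,
    toOp_wCircuit, V2, V, List.map_map, mul_assoc]
  simp only [Function.comp_def, toOp_wCircuit]

/-- The number of CNOTs of one second-order step on `n` qubits. -/
def stepCount (n : ℕ) : ℕ := ∑ k ∈ Finset.range n, wCount k

theorem nonlocalCount_v2Circuit (hn : 0 < n) (θ lam : ℝ) :
    (v2Circuit hn θ lam).nonlocalCount = stepCount n := by
  rw [v2Circuit, Circuit.nonlocalCount_append, Circuit.nonlocalCount_append,
    Circuit.nonlocalCount_flatten, nonlocalCount_wCircuit, nonlocalCount_wCircuit, List.map_map]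
  simp only [Function.comp_def, nonlocalCount_wCircuit]
  -- The two outer rotations act on the lowest qubit and have no controls, so symmetrisation costs
  -- no CNOT.
  rw [show wCount 0 = 0 from rfl, zero_add, add_zero, stepCount, Finset.sum_range,
    ← Fin.sum_univ_def]

/-- Summing `18 * k` over `k < n` gives `9 * n ^ 2 - 9 * n`, and the deficit of at most 32 per term
makes `41 = 9 + 32`. -/
theorem stepCount_bounds (n : ℕ) :
    (stepCount n : ℝ) ≤ 9 * (n : ℝ) ^ 2 ∧ 9 * (n : ℝ) ^ 2 ≤ stepCount n + 41 * n := by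
  induction n with
  | zero => simp [stepCount]
  | succ n ih =>
    have e : stepCount (n + 1) = stepCount n + wCount n := Finset.sum_range_succ _ _
    obtain ⟨h1, h2⟩ := wCount_bounds n
    have h1 : (wCount n : ℝ) ≤ 18 * n := by exact_mod_cast h1
    have h2 : 18 * (n : ℝ) ≤ wCount n + 32 := by exact_mod_cast h2
    rw [e]
    push_cast
    constructor <;> nlinarith [ih.1, ih.2]

end StepCircuit

/-! ### Error of the Strang splitting -/

section Strang

open NormedSpace

theorem norm_le_of_deriv_le_pow {E : Type*} [NormedAddCommGroup E] [NormedSpace ℝ E]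
    {f f' : ℝ → E} {c : ℝ} (k : ℕ) (h0 : f 0 = 0) (hf : ∀ t, HasDerivAt f (f' t) t)
    (hb : ∀ t, 0 ≤ t → ‖f' t‖ ≤ c * t ^ k) {t : ℝ} (ht : 0 ≤ t) :
    ‖f t‖ ≤ c * (t ^ (k + 1) / (k + 1)) := by
  refine image_norm_le_of_norm_deriv_right_le_deriv_boundary (a := 0) (b := t) (f := f) (f' := f')
    (B := fun s => c * (s ^ (k + 1) / (k + 1))) (B' := fun s => c * s ^ k)
    (fun s _ => (hf s).continuousAt.continuousWithinAt) (fun s _ => (hf s).hasDerivWithinAt)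
    (by simp [h0]) (fun s => ?_) (fun s hs => hb s hs.1) ⟨ht, le_rfl⟩
  have hk : (k : ℝ) + 1 ≠ 0 := by positivity
  have h := ((hasDerivAt_pow (k + 1) s).div_const ((k : ℝ) + 1)).const_mul c
  refine h.congr_deriv ?_
  push_cast
  field_simp

variable {A : Type*} [NormedRing A] [NormedAlgebra ℝ A] [CompleteSpace A]

theorem hasDerivAt_exp_conj (X Y : A) (t : ℝ) :
    HasDerivAt (fun s : ℝ => exp (s • X) * Y * exp (s • -X))
      (exp (t • X) * (X * Y - Y * X) * exp (t • -X)) t := by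
  have h := ((hasDerivAt_exp_smul_const X t).mul_const Y).mul (hasDerivAt_exp_smul_const' (-X) t)
  refine h.congr_deriv ?_
  simp only [mul_sub, sub_mul, mul_assoc, neg_mul, mul_neg]
  abel

/-- The derivative of a conjugated operator is the conjugated commutator, so the Taylor remainder
follows by integrating twice. Norms do not grow, because the exponentials are contractions for both
signs of `t`. -/
theorem norm_exp_conj_sub_le {X : A} (Y : A) (hX : ∀ t : ℝ, ‖exp (t • X)‖ ≤ 1) {t : ℝ}
    (ht : 0 ≤ t) :
    ‖exp (t • X) * Y * exp (t • -X) - Y - t • (X * Y - Y * X)‖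
      ≤ ‖X * (X * Y - Y * X) - (X * Y - Y * X) * X‖ * (t ^ 2 / 2) := by
  set C := X * Y - Y * X with hC
  have hX' : ∀ t : ℝ, ‖exp (t • -X)‖ ≤ 1 := fun t => by simpa using hX (-t)
  have hb : ∀ (Z : A) (t : ℝ), ‖exp (t • X) * Z * exp (t • -X)‖ ≤ ‖Z‖ := by
    intro Z t
    calc _ ≤ ‖exp (t • X)‖ * ‖Z‖ * ‖exp (t • -X)‖ := norm_mul₃_le
      _ ≤ 1 * ‖Z‖ * 1 := by gcongr; exacts [hX t, hX' t]
      _ = ‖Z‖ := by ring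
  have h1 : ∀ t : ℝ, 0 ≤ t →
      ‖exp (t • X) * C * exp (t • -X) - C‖ ≤ ‖X * C - C * X‖ * t ^ 1 := by
    intro t ht
    have := norm_le_of_deriv_le_pow (f := fun t : ℝ => exp (t • X) * C * exp (t • -X) - C)
      (f' := fun t => exp (t • X) * (X * C - C * X) * exp (t • -X)) (c := ‖X * C - C * X‖) 0
      (by simp) (fun t => (hasDerivAt_exp_conj X C t).sub_const C)
      (fun t _ => by simpa using hb _ t) ht
    simpa using this
  have := norm_le_of_deriv_le_pow
    (f := fun t : ℝ => exp (t • X) * Y * exp (t • -X) - Y - t • C)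
    (f' := fun t => exp (t • X) * C * exp (t • -X) - C) (c := ‖X * C - C * X‖) 1
    (by simp) (fun t => ?_) h1 ht
  · refine this.trans_eq ?_
    norm_num
  · have h := ((hasDerivAt_exp_conj X Y t).sub_const Y).sub
      ((hasDerivAt_id t).smul_const C)
    refine h.congr_deriv ?_
    rw [one_smul]

omit [NormedAlgebra ℝ A] [CompleteSpace A] in
theorem norm_commutator_le (X Y : A) :
    ‖X * (X * Y - Y * X) - (X * Y - Y * X) * X‖ ≤ 4 * ‖X‖ ^ 2 * ‖Y‖ := by
  have h : ∀ P Q : A, ‖P * Q - Q * P‖ ≤ 2 * ‖P‖ * ‖Q‖ := fun P Q =>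
    calc _ ≤ ‖P * Q‖ + ‖Q * P‖ := norm_sub_le _ _
      _ ≤ ‖P‖ * ‖Q‖ + ‖Q‖ * ‖P‖ := add_le_add (norm_mul_le _ _) (norm_mul_le _ _)
      _ = 2 * ‖P‖ * ‖Q‖ := by ring
  calc _ ≤ 2 * ‖X‖ * ‖X * Y - Y * X‖ := h _ _
    _ ≤ 2 * ‖X‖ * (2 * ‖X‖ * ‖Y‖) := by gcongr; exact h _ _
    _ = _ := by ring

theorem exp_smul_mul_exp_smul_neg (X : A) (t : ℝ) : exp (t • X) * exp (t • -X) = 1 := by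
  let +nondep : NormedAlgebra ℚ A := .restrictScalars ℚ ℝ A
  have hc : Commute (t • X) (t • -X) := by
    rw [smul_neg]; exact (Commute.refl _).neg_right
  rw [← exp_add_of_commute hc, smul_neg, add_neg_cancel, exp_zero]

/-- The error of one step of the symmetric second-order splitting. -/
theorem norm_strang_sub_exp_le_of_nonneg {a B : A} (ha : ∀ t : ℝ, ‖exp (t • a)‖ ≤ 1)
    (hB : ∀ t : ℝ, ‖exp (t • B)‖ ≤ 1) (hH : ∀ t : ℝ, ‖exp (t • (a + B + a))‖ ≤ 1)
    {t : ℝ} (ht : 0 ≤ t) :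
    ‖exp (t • (a + B + a)) - exp (t • a) * exp (t • B) * exp (t • a)‖
      ≤ (4 * ‖B‖ ^ 2 * ‖a‖ + 4 * ‖a‖ ^ 2 * ‖B‖) / 6 * t ^ 3 := by
  set H := a + B + a with hHdef
  -- In the frame moving with the exact flow, the derivative involves `exp (tB) a exp (-tB) - a`
  -- minus `exp (-ta) B exp (ta) - B`. By symmetry of the splitting both have the linear term `t (B
  -- a - a B)`, so only the two second-order remainders survive.
  have hderiv : ∀ t : ℝ, HasDerivAt
      (fun t : ℝ => exp (t • -H) * (exp (t • a) * exp (t • B) * exp (t • a)) - 1)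
      (exp (t • -H) * (exp (t • a) *
        ((exp (t • B) * a * exp (t • -B) - a - t • (B * a - a * B)) -
          (exp (t • -a) * B * exp (t • - -a) - B - t • (-a * B - B * -a))) *
        exp (t • B) * exp (t • a))) t := by
    intro t
    have hS := ((hasDerivAt_exp_smul_const a t).mul (hasDerivAt_exp_smul_const' B t)).mul
      (hasDerivAt_exp_smul_const' a t)
    refine (((hasDerivAt_exp_smul_const (-H) t).mul hS).sub_const 1).congr_deriv ?_
    have e1 : exp (t • -B) * exp (t • B) = 1 := by
      simpa using exp_smul_mul_exp_smul_neg (-B) t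
    have e2 : exp (t • a) * exp (t • -a) = 1 := exp_smul_mul_exp_smul_neg a t
    have e3 : exp (t • a) * a = a * exp (t • a) :=
      ((Commute.refl a).smul_left t).exp_left.eq
    have e4 : t • (-a * B - B * -a) = t • (B * a - a * B) := by
      congr 1; simp only [neg_mul, mul_neg]; abel
    have e5 : exp (t • a) * (exp (t • B) * a * exp (t • -B) - a -
        (exp (t • -a) * B * exp (t • a) - B)) * exp (t • B) * exp (t • a)
        = exp (t • a) * exp (t • B) * a * exp (t • a) - exp (t • a) * a * exp (t • B) * exp (t • a)
          - B * exp (t • a) * exp (t • B) * exp (t • a)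
          + exp (t • a) * B * exp (t • B) * exp (t • a) := by
      have f1 : exp (t • a) * (exp (t • B) * a * exp (t • -B)) * exp (t • B) * exp (t • a)
          = exp (t • a) * exp (t • B) * a * exp (t • a) := by
        calc _ = exp (t • a) * exp (t • B) * a * (exp (t • -B) * exp (t • B)) * exp (t • a) := by
              simp only [mul_assoc]
          _ = _ := by rw [e1, mul_one]
      have f2 : exp (t • a) * (exp (t • -a) * B * exp (t • a)) * exp (t • B) * exp (t • a)
          = B * exp (t • a) * exp (t • B) * exp (t • a) := by
        calc _ = (exp (t • a) * exp (t • -a)) * B * exp (t • a) * exp (t • B) * exp (t • a) := by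
              simp only [mul_assoc]
          _ = _ := by rw [e2, one_mul]
      rw [← f1, ← f2]
      simp only [mul_sub, sub_mul]
      abel
    rw [e4, sub_sub_sub_cancel_right, neg_neg, e5, hHdef]
    have e6 : a * (exp (t • a) * exp (t • B) * exp (t • a))
        = exp (t • a) * a * exp (t • B) * exp (t • a) := by
      rw [e3]; simp only [mul_assoc]
    have e7 : exp (t • -(a + B + a)) * -(a + B + a) *
        (exp (t • a) * exp (t • B) * exp (t • a)) = exp (t • -(a + B + a)) *
        (- (exp (t • a) * a * exp (t • B) * exp (t • a)) -
          B * exp (t • a) * exp (t • B) * exp (t • a)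
          - (exp (t • a) * a * exp (t • B) * exp (t • a))) := by
      rw [mul_assoc, neg_mul, add_mul, add_mul, e6]
      congr 1
      simp only [mul_assoc]
      abel
    simp only [Pi.mul_apply]
    rw [e7, ← mul_add]
    congr 1
    simp only [mul_assoc, add_mul]
    abel
  have hmul : ∀ P Q R : A, ‖P‖ ≤ 1 → ‖R‖ ≤ 1 → ‖P * Q * R‖ ≤ ‖Q‖ := fun P Q R hP hR =>
    calc _ ≤ ‖P‖ * ‖Q‖ * ‖R‖ := norm_mul₃_le
      _ ≤ 1 * ‖Q‖ * 1 := by gcongr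
      _ = ‖Q‖ := by ring
  have hH' : ∀ t : ℝ, ‖exp (t • -H)‖ ≤ 1 := fun t => by simpa using hH (-t)
  have ha' : ∀ t : ℝ, ‖exp (t • -a)‖ ≤ 1 := fun t => by simpa using ha (-t)
  have hBa : ∀ t : ℝ, ‖exp (t • B) * exp (t • a)‖ ≤ 1 := fun t =>
    (norm_mul_le _ _).trans (mul_le_one₀ (hB t) (norm_nonneg _) (ha t))
  -- Each remainder is a double commutator times `s ^ 2 / 2`; integration over `s` turns this into
  -- `t ^ 3 / 6`.
  have hG := norm_le_of_deriv_le_pow (c := (4 * ‖B‖ ^ 2 * ‖a‖ + 4 * ‖a‖ ^ 2 * ‖B‖) / 2) 2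
    (by simp) hderiv (fun s hs => ?_) ht
  · have e : exp (t • H) - exp (t • a) * exp (t • B) * exp (t • a)
        = -(exp (t • H) *
          (exp (t • -H) * (exp (t • a) * exp (t • B) * exp (t • a)) - 1)) := by
      rw [mul_sub, ← mul_assoc (exp (t • H)), exp_smul_mul_exp_smul_neg, one_mul, mul_one, neg_sub]
    rw [e, norm_neg]
    calc _ ≤ ‖exp (t • H)‖ * _ := norm_mul_le _ _
      _ ≤ 1 * ((4 * ‖B‖ ^ 2 * ‖a‖ + 4 * ‖a‖ ^ 2 * ‖B‖) / 2 * (t ^ (2 + 1) / ((2 : ℕ) + 1))) :=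
        mul_le_mul (hH t) hG (norm_nonneg _) zero_le_one
      _ = _ := by push_cast; ring
  · have hn : ‖-a‖ = ‖a‖ := norm_neg a
    have b1 := (norm_exp_conj_sub_le a hB hs).trans
      (mul_le_mul_of_nonneg_right (norm_commutator_le B a) (by positivity))
    have b2 := (norm_exp_conj_sub_le B ha' hs).trans
      (mul_le_mul_of_nonneg_right (norm_commutator_le (-a) B) (by positivity))
    rw [hn] at b2
    rw [mul_assoc (exp (s • a) * _), ← one_mul (_ * s ^ 2)]
    refine (norm_mul_le _ _).trans (mul_le_mul (hH' s) ?_ (norm_nonneg _) zero_le_one)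
    refine (hmul _ _ _ (ha s) (hBa s)).trans ?_
    refine (norm_sub_le _ _).trans ((add_le_add b1 b2).trans_eq ?_)
    ring

/-- With `a = X / 2` the constant is at most `(4 / 2 + 4 / 4) / 6 = 1 / 2`. Negative times reduce to
positive ones by negating both generators. -/
theorem norm_strang_sub_exp_le {X B : A} (hX : ∀ t : ℝ, ‖exp (t • X)‖ ≤ 1)
    (hB : ∀ t : ℝ, ‖exp (t • B)‖ ≤ 1) (hH : ∀ t : ℝ, ‖exp (t • (X + B))‖ ≤ 1)
    (hX1 : ‖X‖ ≤ 1) (hB1 : ‖B‖ ≤ 1) (t : ℝ) :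
    ‖exp (t • (X + B)) - exp ((t / 2) • X) * exp (t • B) * exp ((t / 2) • X)‖ ≤ |t| ^ 3 / 2 := by
  have key : ∀ {X B : A}, (∀ t : ℝ, ‖exp (t • X)‖ ≤ 1) → (∀ t : ℝ, ‖exp (t • B)‖ ≤ 1) →
      (∀ t : ℝ, ‖exp (t • (X + B))‖ ≤ 1) → ‖X‖ ≤ 1 → ‖B‖ ≤ 1 → ∀ t : ℝ, 0 ≤ t →
      ‖exp (t • (X + B)) - exp ((t / 2) • X) * exp (t • B) * exp ((t / 2) • X)‖
        ≤ t ^ 3 / 2 := by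
    intro X B hX hB hH hX1 hB1 t ht
    have e : (1 / 2 : ℝ) • X + B + (1 / 2 : ℝ) • X = X + B := by
      rw [add_right_comm, ← add_smul]; norm_num
    have e' : ∀ t : ℝ, t • (1 / 2 : ℝ) • X = (t / 2) • X := fun t => by
      rw [smul_smul]; congr 1; ring
    have h := norm_strang_sub_exp_le_of_nonneg (a := (1 / 2 : ℝ) • X) (B := B)
      (fun t => by rw [e']; exact hX _) hB (fun t => by rw [e]; exact hH t) ht
    rw [e, e'] at h
    refine h.trans ?_
    have hn : ‖(1 / 2 : ℝ) • X‖ ≤ 1 / 2 := by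
      rw [norm_smul]; norm_num; linarith
    have : 4 * ‖B‖ ^ 2 * ‖(1 / 2 : ℝ) • X‖ + 4 * ‖(1 / 2 : ℝ) • X‖ ^ 2 * ‖B‖
        ≤ 4 * 1 ^ 2 * (1 / 2) + 4 * (1 / 2) ^ 2 * 1 := by gcongr
    calc _ ≤ (4 * 1 ^ 2 * (1 / 2) + 4 * (1 / 2) ^ 2 * 1) / 6 * t ^ 3 := by gcongr
      _ = t ^ 3 / 2 := by ring
  rcases le_total 0 t with ht | ht
  · rw [abs_of_nonneg ht]
    exact key hX hB hH hX1 hB1 t ht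
  · have h := key (X := -X) (B := -B) (fun t => by simpa using hX (-t))
      (fun t => by simpa using hB (-t)) (fun t => by
        rw [← neg_add, smul_neg, ← neg_smul]; exact hH (-t))
      (by simpa using hX1) (by simpa using hB1) (-t) (by linarith)
    rw [abs_of_nonpos ht]
    rw [← neg_add, neg_smul_neg, neg_smul_neg, neg_div, neg_smul_neg] at h
    exact h

end Strang

/-! ### The gates `W` as exponentials of hopping terms -/

section RegisterHamiltonian

variable {n : ℕ}

theorem tensor_mul_onQubit {ι : Type} [Fintype ι] [DecidableEq ι] (q : ι)
    (A : Matrix (Fin 2) (Fin 2) ℂ) (B : ι → Matrix (Fin 2) (Fin 2) ℂ) :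
    tensor B * onQubit q A = tensor (Function.update B q (B q * A)) := by
  rw [onQubit, tensor_mul]
  congr 1
  ext1 k
  by_cases h : k = q
  · subst h; simp
  · simp [Function.update_of_ne h]

theorem rz_eq_diagonal (θ : ℝ) : rz θ = Matrix.diagonal
    ![Complex.exp (-(Complex.I * θ / 2)), Complex.exp (Complex.I * θ / 2)] := by
  ext i j; fin_cases i <;> fin_cases j <;> simp [rz]

theorem sigma11_eq_diagonal : sigma11 = Matrix.diagonal ![0, 1] := by
  ext i j; fin_cases i <;> fin_cases j <;> simp [sigma11]

theorem pauliZ_eq_diagonal : pauliZ = Matrix.diagonal ![1, -1] := by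
  ext i j; fin_cases i <;> fin_cases j <;> simp [pauliZ]

theorem allOnes_eq_diagonal (l : List (Fin n)) : allOnes l =
    Matrix.diagonal fun x => ∏ k, if k ∈ l then (![0, 1] : Fin 2 → ℂ) (x k) else 1 := by
  rw [allOnes_eq_tensor]
  have : (fun k : Fin n => if k ∈ l then sigma11 else 1)
      = fun k => Matrix.diagonal (if k ∈ l then ![0, 1] else 1) := by
    ext1 k
    split_ifs
    · exact sigma11_eq_diagonal
    · exact Matrix.diagonal_one.symm
  rw [this, tensor_diagonal]
  congr 1
  ext x
  refine Finset.prod_congr rfl fun k _ => ?_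
  split_ifs <;> rfl

theorem onQubit_diagonal (j : Fin n) (v : Fin 2 → ℂ) :
    onQubit j (Matrix.diagonal v) = Matrix.diagonal fun x => v (x j) := by
  have : Function.update (fun _ => (1 : Matrix (Fin 2) (Fin 2) ℂ)) j (Matrix.diagonal v)
      = fun k => Matrix.diagonal (Function.update (fun _ => (1 : Fin 2 → ℂ)) j v k) := by
    ext1 k
    by_cases h : k = j
    · subst h; simp
    · simp only [Function.update_of_ne h]; exact Matrix.diagonal_one.symm
  rw [onQubit, this, tensor_diagonal]
  congr 1
  ext x
  rw [Finset.prod_eq_single j]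
  · simp
  · intro k _ hk; simp [Function.update_of_ne hk]
  · simp

/-- `Z` on qubit `j`, on the states in which the qubits below `j` are `1`. -/
def ctlZ (j : Fin n) : Op (Fin n) := allOnes (below j) * onQubit j pauliZ

/-- Both sides are diagonal. The diagonal of the control projection takes only the values 0, where
the exponential is 1, and 1, where it is the phase of `rz`. -/
theorem mcrz_eq_exp (j : Fin n) (θ : ℝ) :
    mcrz j (2 * θ) = NormedSpace.exp ((-(Complex.I * θ)) • ctlZ j) := by
  rw [mcrz_eq_ctl, ctlZ, ctl, allOnes_eq_diagonal, rz_eq_diagonal, pauliZ_eq_diagonal,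
    onQubit_diagonal, onQubit_diagonal, Matrix.diagonal_mul_diagonal, Matrix.diagonal_mul_diagonal,
    ← Matrix.diagonal_smul, Matrix.exp_diagonal, ← Matrix.diagonal_one, Matrix.diagonal_sub,
    Matrix.diagonal_add]
  congr 1
  ext x
  rw [Pi.coe_exp, ← Complex.exp_eq_exp_ℂ]
  set p := ∏ k, if k ∈ below j then (![0, 1] : Fin 2 → ℂ) (x k) else 1 with hp
  have hpp : p * p = p := by
    rw [hp, ← Finset.prod_mul_distrib]
    refine Finset.prod_congr rfl fun k _ => ?_
    split_ifs
    · generalize x k = b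
      fin_cases b <;> simp
    · simp
  have h01 : p = 0 ∨ p = 1 := by
    rcases eq_or_ne p 0 with h | h
    · exact Or.inl h
    · exact Or.inr (mul_left_cancel₀ h (by rw [hpp, mul_one]))
  simp only [Pi.smul_apply, smul_eq_mul]
  rw [← hp]
  generalize x j = b
  rcases h01 with h | h <;> rw [h]
  · simp
  · fin_cases b <;> simp <;> congr 1 <;> ring

/-- The product of the `X` gates below `j`. -/
def flips (j : Fin n) : Op (Fin n) := tensor fun k => if k < j then pauliX else 1

theorem prod_onQubit_pauliX {l : List (Fin n)} (h : l.Nodup) :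
    (l.map fun q => onQubit q pauliX).prod = tensor fun k => if k ∈ l then pauliX else 1 := by
  induction l with
  | nil => simp [tensor_one]
  | cons q l ih =>
    rw [List.nodup_cons] at h
    rw [List.map_cons, List.prod_cons, ih h.2, onQubit_mul_tensor]
    congr 1
    ext1 k
    by_cases hk : k = q
    · subst hk; simp [h.1]
    · simp [hk]

theorem prod_cnot (j : Fin n) {l : List (Fin n)} (h : j ∉ l) :
    (l.map fun m => cnot j m).prod
      = ctl (onQubit j sigma11) (l.map fun q => onQubit q pauliX).prod := by
  induction l with
  | nil => simp [ctl_one]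
  | cons q l ih =>
    rw [List.mem_cons, not_or] at h
    rw [List.map_cons, List.prod_cons, ih h.2, cnot_eq_ctl h.1,
      ctl_mul (sigma11_idem j) (onQubit_commute h.1 _ _), List.map_cons, List.prod_cons]

theorem flips_commute (j : Fin n) (A : Matrix (Fin 2) (Fin 2) ℂ) :
    Commute (onQubit j A) (flips j) := by
  rw [Commute, SemiconjBy, flips, onQubit_mul_tensor, tensor_mul_onQubit]
  simp

theorem prod_cnot_below (j : Fin n) :
    ((below j).map fun m => cnot j m).prod = ctl (onQubit j sigma11) (flips j) := by
  rw [prod_cnot j (by simp [mem_below]), prod_onQubit_pauliX (nodup_below j), flips]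
  simp only [mem_below]

theorem flips_conjTranspose (j : Fin n) : (flips j).conjTranspose = flips j := by
  rw [flips, tensor_conjTranspose]
  congr 1
  ext1 k
  split_ifs
  · exact pauliX_conjTranspose
  · exact Matrix.conjTranspose_one

theorem sigma11_conjTranspose : sigma11.conjTranspose = sigma11 := by
  ext i j; fin_cases i <;> fin_cases j <;> simp [sigma11]

theorem ctl_flips_conjTranspose (j : Fin n) :
    (ctl (onQubit j sigma11) (flips j)).conjTranspose = ctl (onQubit j sigma11) (flips j) := by
  rw [ctl, Matrix.conjTranspose_add, Matrix.conjTranspose_sub, Matrix.conjTranspose_mul,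
    flips_conjTranspose, onQubit_conjTranspose, sigma11_conjTranspose, Matrix.conjTranspose_one,
    (flips_commute j _).eq]

/-- `σ₀₁` maps `1` to `0` on qubit `j`: the right controlled flip is active and the left one idle.
Below `j` this leaves `σ₁₁ X = σ₁₀`. -/
theorem ctl_flips_conj_sigma01 (j : Fin n) :
    ctl (onQubit j sigma11) (flips j) * (onQubit j sigma01 * allOnes (below j))
      * ctl (onQubit j sigma11) (flips j) = sMinus j := by
  have h1 : ctl (onQubit j sigma11) (flips j) * onQubit j sigma01 = onQubit j sigma01 := by
    have : onQubit j sigma11 * onQubit j sigma01 = 0 := by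
      rw [← onQubit_mul, show sigma11 * sigma01 = 0 by
        ext a b; fin_cases a <;> fin_cases b <;> simp [sigma11, sigma01, Matrix.mul_apply]]
      exact map_zero (onQubitHom j)
    rw [ctl, (flips_commute j _).eq, add_mul, sub_mul, mul_assoc, this]
    simp
  have h2 : onQubit j sigma01 * ctl (onQubit j sigma11) (flips j)
      = onQubit j sigma01 * flips j := by
    have : onQubit j sigma01 * onQubit j sigma11 = onQubit j sigma01 := by
      rw [← onQubit_mul, show sigma01 * sigma11 = sigma01 by
        ext a b; fin_cases a <;> fin_cases b <;> simp [sigma11, sigma01, Matrix.mul_apply]]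
    rw [ctl, mul_add, mul_sub, ← mul_assoc, this]
    simp
  have hc : Commute (allOnes (below j)) (onQubit j sigma01) :=
    allOnes_commute_onQubit (by simp [mem_below]) _
  rw [← mul_assoc, h1, ← hc.eq, mul_assoc, h2, ← mul_assoc, hc.eq, mul_assoc, allOnes_eq_tensor,
    flips, tensor_mul, onQubit_mul_tensor, sMinus]
  congr 1
  ext1 k
  by_cases hk : k = j
  · subst hk; simp [mem_below]
  · simp only [Function.update_of_ne hk, if_neg hk, mem_below]
    split_ifs
    · ext a b; fin_cases a <;> fin_cases b <;> simp [sigma11, sigma10, pauliX, Matrix.mul_apply]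
    · exact one_mul 1

theorem sigma01_conjTranspose : sigma01.conjTranspose = sigma10 := by
  ext i j; fin_cases i <;> fin_cases j <;> simp [sigma01, sigma10]

theorem sMinus_conjTranspose (j : Fin n) : (sMinus j).conjTranspose = sPlus j := by
  rw [sMinus, tensor_conjTranspose, sPlus]
  congr 1
  ext1 k
  split_ifs
  · exact sigma01_conjTranspose
  · rw [← sigma01_conjTranspose, Matrix.conjTranspose_conjTranspose]
  · exact Matrix.conjTranspose_one

theorem sPlus_conjTranspose (j : Fin n) : (sPlus j).conjTranspose = sMinus j := by
  rw [← sMinus_conjTranspose, Matrix.conjTranspose_conjTranspose]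

theorem allOnes_conjTranspose (l : List (Fin n)) : (allOnes l).conjTranspose = allOnes l := by
  rw [allOnes_eq_tensor, tensor_conjTranspose]
  congr 1
  ext1 k
  split_ifs
  · exact sigma11_conjTranspose
  · exact Matrix.conjTranspose_one

theorem ctl_flips_conj_sigma10 (j : Fin n) :
    ctl (onQubit j sigma11) (flips j) * (onQubit j sigma10 * allOnes (below j))
      * ctl (onQubit j sigma11) (flips j) = sPlus j := by
  have hc : Commute (allOnes (below j)) (onQubit j sigma10) :=
    allOnes_commute_onQubit (by simp [mem_below]) _
  rw [← sMinus_conjTranspose, ← ctl_flips_conj_sigma01, Matrix.conjTranspose_mul,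
    Matrix.conjTranspose_mul, Matrix.conjTranspose_mul, ctl_flips_conjTranspose,
    onQubit_conjTranspose, sigma01_conjTranspose, allOnes_conjTranspose, hc.eq, mul_assoc]

/-- The term `e^{i lam} s⁻_j + e^{-i lam} s⁺_j` of the Hamiltonian. -/
def hop (j : Fin n) (lam : ℝ) : Op (Fin n) :=
  Complex.exp (Complex.I * lam) • sMinus j + Complex.exp (-(Complex.I * lam)) • sPlus j

theorem bellU_eq (j : Fin n) (lam : ℝ) : bellU j lam =
    ctl (onQubit j sigma11) (flips j) * onQubit j (phaseGate lam * hadamard) := by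
  rw [bellU, ← prod_cnot_below, onQubit_mul, mul_assoc]
  rfl

/-- The Hadamard turns `Z` into `X = σ₀₁ + σ₁₀`, the phase gate attaches the two phases, and the
CNOTs turn the projection below `j` into the lowering and raising strings. -/
theorem bellU_conj_ctlZ (j : Fin n) (lam : ℝ) :
    bellU j (-lam) * ctlZ j * (bellU j (-lam)).conjTranspose = hop j lam := by
  have hc : ∀ A, Commute (allOnes (below j)) (onQubit j A) := fun A =>
    allOnes_commute_onQubit (by simp [mem_below]) _
  have hQ : phaseGate (-lam) * hadamard * pauliZ * (phaseGate (-lam) * hadamard).conjTranspose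
      = Complex.exp (Complex.I * lam) • sigma01 + Complex.exp (-(Complex.I * lam)) • sigma10 := by
    have hZ : hadamard * pauliZ * hadamard = pauliX := by
      rw [← hadamard_mul_pauliX_mul_hadamard, ← mul_assoc, ← mul_assoc, hadamard_mul_self, one_mul,
        mul_assoc, hadamard_mul_self, mul_one]
    rw [Matrix.conjTranspose_mul, hadamard_conjTranspose, phaseGate_conjTranspose, neg_neg]
    calc _ = phaseGate (-lam) * (hadamard * pauliZ * hadamard) * phaseGate lam := by
          simp only [mul_assoc]
      _ = _ := by
        rw [hZ]
        ext a b
        fin_cases a <;> fin_cases b <;>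
          simp [phaseGate, pauliX, sigma01, sigma10, Matrix.mul_apply]
  rw [bellU_eq, Matrix.conjTranspose_mul, ctl_flips_conjTranspose, onQubit_conjTranspose, ctlZ]
  calc _ = ctl (onQubit j sigma11) (flips j) *
        (onQubit j (phaseGate (-lam) * hadamard) * allOnes (below j) * onQubit j pauliZ *
          onQubit j (phaseGate (-lam) * hadamard).conjTranspose) *
        ctl (onQubit j sigma11) (flips j) := by simp only [mul_assoc]
    _ = ctl (onQubit j sigma11) (flips j) *
        (onQubit j (phaseGate (-lam) * hadamard * pauliZ *
          (phaseGate (-lam) * hadamard).conjTranspose) * allOnes (below j)) *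
        ctl (onQubit j sigma11) (flips j) := by
      rw [← (hc _).eq, mul_assoc (allOnes _), mul_assoc (allOnes _), ← onQubit_mul, ← onQubit_mul,
        (hc _).eq]
    _ = hop j lam := by
      rw [hQ, onQubit_add, add_mul, mul_add, add_mul, hop, ← ctl_flips_conj_sigma01 j,
        ← ctl_flips_conj_sigma10 j]
      have hs : ∀ (c : ℂ) (A : Matrix (Fin 2) (Fin 2) ℂ), onQubit j (c • A) = c • onQubit j A :=
        fun c A => map_smul (onQubitHom j) c A
      simp only [hs, smul_mul_assoc, mul_smul_comm]

theorem bellU_mul_conjTranspose (j : Fin n) (lam : ℝ) :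
    bellU j lam * (bellU j lam).conjTranspose = 1 := by
  rw [← toOp_bellCircuit, Circuit.toOp_mul_conjTranspose]

theorem W_eq_exp (j : Fin n) (θ lam : ℝ) :
    W j θ lam = NormedSpace.exp (θ • (-Complex.I) • hop j lam) := by
  have hU := bellU_mul_conjTranspose j (-lam)
  have hU' := mul_eq_one_comm.mp hU
  have h := Matrix.exp_units_conj ⟨_, _, hU, hU'⟩ ((-(Complex.I * θ)) • ctlZ j)
  have e : θ • (-Complex.I) • hop j lam = bellU j (-lam) * ((-(Complex.I * θ)) • ctlZ j) *
      (bellU j (-lam)).conjTranspose := by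
    rw [mul_smul_comm, smul_mul_assoc, bellU_conj_ctlZ, ← Complex.coe_smul, smul_smul,
      mul_neg, mul_comm]
  rw [W, mcrz_eq_exp, e]
  exact h.symm

/-- The square is the control projection. Passed on to the hopping terms by conjugation, the
identity yields their norm bound. -/
theorem ctlZ_cube (j : Fin n) : ctlZ j * ctlZ j * ctlZ j = ctlZ j := by
  have hc : Commute (allOnes (below j)) (onQubit j pauliZ) :=
    allOnes_commute_onQubit (by simp [mem_below]) _
  have h : ctlZ j * ctlZ j = allOnes (below j) := by
    rw [ctlZ]
    calc _ = allOnes (below j) * (onQubit j pauliZ * allOnes (below j)) * onQubit j pauliZ := by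
          simp only [mul_assoc]
      _ = allOnes (below j) * allOnes (below j) * (onQubit j pauliZ * onQubit j pauliZ) := by
          rw [← hc.eq]; simp only [mul_assoc]
      _ = _ := by rw [allOnes_mul_self, ← onQubit_mul, pauliZ_mul_self, onQubit_one, mul_one]
  rw [h, ctlZ, ← mul_assoc, allOnes_mul_self]

theorem hop_cube (j : Fin n) (lam : ℝ) : hop j lam * hop j lam * hop j lam = hop j lam := by
  have hU' := mul_eq_one_comm.mp (bellU_mul_conjTranspose j (-lam))
  rw [← bellU_conj_ctlZ]
  set U := bellU j (-lam)
  calc _ = U * ctlZ j * (U.conjTranspose * U) * ctlZ j * (U.conjTranspose * U) * ctlZ j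
        * U.conjTranspose := by simp only [mul_assoc]
    _ = U * (ctlZ j * ctlZ j * ctlZ j) * U.conjTranspose := by
      rw [hU', mul_one, mul_one]; simp only [mul_assoc]
    _ = _ := by rw [ctlZ_cube]

theorem hop_conjTranspose (j : Fin n) (lam : ℝ) : (hop j lam).conjTranspose = hop j lam := by
  rw [hop, Matrix.conjTranspose_add, Matrix.conjTranspose_smul, Matrix.conjTranspose_smul,
    sMinus_conjTranspose, sPlus_conjTranspose, add_comm]
  congr 2 <;> simp [← Complex.exp_conj]

/-- Some qubit always sees `σ₀₁ σ₀₁` or `σ₁₀ σ₁₀`: the lowest one when both factors are lowering or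
both raising, qubit `i` in the mixed cases. The first kind needs a qubit below `i`, which is why the
term on the lowest qubit is excluded. -/
theorem hop_mul_hop {i j : Fin n} (h0 : 0 < i.val) (hij : i < j) (lam : ℝ) :
    hop i lam * hop j lam = 0 := by
  have z01 : sigma01 * sigma01 = 0 := by
    ext a b; fin_cases a <;> fin_cases b <;> simp [sigma01, Matrix.mul_apply]
  have z10 : sigma10 * sigma10 = 0 := by
    ext a b; fin_cases a <;> fin_cases b <;> simp [sigma10, Matrix.mul_apply]
  let z : Fin n := ⟨0, by omega⟩
  have hzi : z < i := h0
  have hzj : z < j := hzi.trans hij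
  have h1 : sMinus i * sMinus j = 0 := by
    rw [sMinus, sMinus, tensor_mul]
    exact tensor_eq_zero _ z (by simp [hzi, hzj, hzi.ne, hzj.ne, z10])
  have h2 : sMinus i * sPlus j = 0 := by
    rw [sMinus, sPlus, tensor_mul]
    exact tensor_eq_zero _ i (by simp [hij, hij.ne, z01])
  have h3 : sPlus i * sMinus j = 0 := by
    rw [sMinus, sPlus, tensor_mul]
    exact tensor_eq_zero _ i (by simp [hij, hij.ne, z10])
  have h4 : sPlus i * sPlus j = 0 := by
    rw [sPlus, sPlus, tensor_mul]
    exact tensor_eq_zero _ z (by simp [hzi, hzj, hzi.ne, hzj.ne, z01])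
  simp [hop, add_mul, mul_add, h1, h2, h3, h4]

theorem hop_mul_hop_of_ne {i j : Fin n} (hi : 0 < i.val) (hj : 0 < j.val) (hij : i ≠ j) (lam : ℝ) :
    hop i lam * hop j lam = 0 := by
  rcases lt_or_gt_of_ne hij with h | h
  · exact hop_mul_hop hi h lam
  · have := congrArg Matrix.conjTranspose (hop_mul_hop hj h lam)
    rwa [Matrix.conjTranspose_mul, hop_conjTranspose, hop_conjTranspose,
      Matrix.conjTranspose_zero] at this

end RegisterHamiltonian

/-! ### Norm bounds, telescoping and commuting exponentials -/

section NormBounds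

/-- From `X ^ 4 = X ^ 2` and the C⋆-identity, `‖X‖ ^ 4 = ‖X‖ ^ 2`. -/
theorem norm_le_one_of_cube {A : Type*} [NormedRing A] [StarRing A] [CStarRing A] {X : A}
    (h : star X = X) (h3 : X * X * X = X) : ‖X‖ ≤ 1 := by
  have hsq : ∀ Y : A, star Y = Y → ‖Y * Y‖ = ‖Y‖ * ‖Y‖ := fun Y hY => by
    have := CStarRing.norm_star_mul_self (x := Y)
    rwa [hY] at this
  have h4 := hsq (X * X) (by rw [star_mul, h])
  rw [← mul_assoc, h3, hsq X h] at h4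
  by_contra! hlt
  have : 1 < ‖X‖ * ‖X‖ := one_lt_mul_of_lt_of_le hlt hlt.le
  nlinarith

theorem norm_list_prod_le_one {A : Type*} [NormedRing A] [NormOneClass A] {l : List A}
    (h : ∀ x ∈ l, ‖x‖ ≤ 1) : ‖l.prod‖ ≤ 1 := by
  induction l with
  | nil => simp
  | cons x l ih =>
    rw [List.prod_cons]
    exact (norm_mul_le _ _).trans (mul_le_one₀ (h x (by simp)) (norm_nonneg _)
      (ih fun y hy => h y (by simp [hy])))

/-- Telescoping: factors are exchanged one at a time, the others being contractions. -/
theorem norm_list_prod_sub_le {A ι : Type*} [NormedRing A] [NormOneClass A] (f g : ι → A)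
    (hf : ∀ i, ‖f i‖ ≤ 1) (hg : ∀ i, ‖g i‖ ≤ 1) (l : List ι) :
    ‖(l.map f).prod - (l.map g).prod‖ ≤ (l.map fun i => ‖f i - g i‖).sum := by
  induction l with
  | nil => simp
  | cons i l ih =>
    have hp : ‖(l.map g).prod‖ ≤ 1 :=
      norm_list_prod_le_one (by simp +contextual [hg])
    simp only [List.map_cons, List.prod_cons, List.sum_cons]
    calc ‖f i * (l.map f).prod - g i * (l.map g).prod‖
        = ‖(f i - g i) * (l.map g).prod + f i * ((l.map f).prod - (l.map g).prod)‖ := by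
          congr 1; rw [sub_mul, mul_sub]; abel
      _ ≤ ‖f i - g i‖ * ‖(l.map g).prod‖ + ‖f i‖ * ‖(l.map f).prod - (l.map g).prod‖ :=
          (norm_add_le _ _).trans (add_le_add (norm_mul_le _ _) (norm_mul_le _ _))
      _ ≤ ‖f i - g i‖ * 1 + 1 * (l.map fun i => ‖f i - g i‖).sum := by
          gcongr; exact hf i
      _ = _ := by rw [mul_one, one_mul]

theorem norm_pow_sub_pow_le {A : Type*} [NormedRing A] [NormOneClass A] {x y : A}
    (hx : ‖x‖ ≤ 1) (hy : ‖y‖ ≤ 1) (r : ℕ) : ‖x ^ r - y ^ r‖ ≤ r * ‖x - y‖ := by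
  have h := norm_list_prod_sub_le (fun _ : ℕ => x) (fun _ => y) (fun _ => hx) (fun _ => hy)
    (List.range r)
  simpa [List.map_const'] using h

variable {ι : Type} [Fintype ι] [DecidableEq ι]

theorem norm_le_one_of_mem_unitary {U : Op ι} (h : U ∈ unitary (Op ι)) : ‖U‖ ≤ 1 :=
  (CStarRing.norm_of_mem_unitary h).le

theorem norm_exp_smul_le {X : Op ι} (hX : X.conjTranspose = X) (t : ℝ) :
    ‖NormedSpace.exp (t • (-Complex.I) • X)‖ ≤ 1 := by
  let +nondep : NormedAlgebra ℚ (Op ι) := .restrictScalars ℚ ℂ (Op ι)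
  refine norm_le_one_of_mem_unitary (NormedSpace.exp_mem_unitary_of_mem_skewAdjoint ?_)
  rw [skewAdjoint.mem_iff, star_smul, star_smul, Matrix.star_eq_conjTranspose, hX]
  simp

theorem exp_list_sum {l : List (Op ι)} (h : ∀ X ∈ l, ∀ Y ∈ l, Commute X Y) :
    (l.map NormedSpace.exp).reverse.prod = NormedSpace.exp l.sum := by
  induction l with
  | nil => simp
  | cons X l ih =>
    have hc : Commute l.sum X :=
      (Commute.list_sum_right X l fun Y hY => h X (by simp) Y (by simp [hY])).symm
    rw [List.map_cons, List.reverse_cons, List.prod_append, List.prod_singleton,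
      ih fun Y hY Z hZ => h Y (by simp [hY]) Z (by simp [hZ]), List.sum_cons, add_comm,
      Matrix.exp_add_of_commute _ _ hc]

end NormBounds

/-! ### Error of a second-order step on one register -/

section StepError

/-- The Hamiltonian of one register, without the factor `γ η`. -/
def regHam (n : ℕ) (lam : ℝ) : Op (Fin n) := ∑ j, hop j lam

theorem regHam_conjTranspose (n : ℕ) (lam : ℝ) : (regHam n lam).conjTranspose = regHam n lam := by
  rw [regHam, Matrix.conjTranspose_sum]
  exact Finset.sum_congr rfl fun j _ => hop_conjTranspose j lam

/-- The terms of the Hamiltonian of one register other than the first one. -/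
def tailHam (m : ℕ) (lam : ℝ) : Op (Fin (m + 1)) := ∑ j : Fin m, hop j.succ lam

theorem tailHam_conjTranspose (m : ℕ) (lam : ℝ) :
    (tailHam m lam).conjTranspose = tailHam m lam := by
  rw [tailHam, Matrix.conjTranspose_sum]
  exact Finset.sum_congr rfl fun j _ => hop_conjTranspose _ lam

theorem hop_succ_mul_hop_succ {m : ℕ} {i j : Fin m} (h : i ≠ j) (lam : ℝ) :
    hop i.succ lam * hop j.succ lam = 0 :=
  hop_mul_hop_of_ne (by simp) (by simp) (fun e => h (Fin.succ_injective _ e)) lam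

/-- All cross products vanish, so the cube is taken term by term. Hence the norm of the tail does
not grow with the number of qubits. -/
theorem tailHam_cube (m : ℕ) (lam : ℝ) :
    tailHam m lam * tailHam m lam * tailHam m lam = tailHam m lam := by
  have h2 : tailHam m lam * tailHam m lam = ∑ j : Fin m, hop j.succ lam * hop j.succ lam := by
    rw [tailHam, Finset.sum_mul_sum]
    refine Finset.sum_congr rfl fun i _ => Finset.sum_eq_single i (fun j _ hj => ?_) (by simp)
    exact hop_succ_mul_hop_succ hj.symm lam
  rw [h2, tailHam, Finset.sum_mul_sum]
  refine Finset.sum_congr rfl fun i _ => ?_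
  rw [Finset.sum_eq_single i (fun j _ hj => ?_) (by simp), hop_cube]
  rw [mul_assoc, hop_succ_mul_hop_succ hj.symm lam, mul_zero]

theorem norm_hop_le {n : ℕ} (j : Fin n) (lam : ℝ) : ‖hop j lam‖ ≤ 1 :=
  norm_le_one_of_cube (hop_conjTranspose j lam) (hop_cube j lam)

theorem norm_tailHam_le (m : ℕ) (lam : ℝ) : ‖tailHam m lam‖ ≤ 1 :=
  norm_le_one_of_cube (tailHam_conjTranspose m lam) (tailHam_cube m lam)

theorem V_eq_exp (m : ℕ) (θ lam : ℝ) : V (m + 1) θ lam =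
    NormedSpace.exp (θ • (-Complex.I) • tailHam m lam) *
      NormedSpace.exp (θ • (-Complex.I) • hop 0 lam) := by
  have hcomm : ∀ X ∈ (List.finRange m).map (fun j => θ • (-Complex.I) • hop j.succ lam),
      ∀ Y ∈ (List.finRange m).map (fun j => θ • (-Complex.I) • hop j.succ lam), Commute X Y := by
    intro X hX Y hY
    obtain ⟨i, -, rfl⟩ := List.mem_map.mp hX
    obtain ⟨j, -, rfl⟩ := List.mem_map.mp hY
    have : Commute (hop i.succ lam) (hop j.succ lam) := by
      by_cases h : i = j
      · subst h; exact Commute.refl _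
      · rw [Commute, SemiconjBy, hop_succ_mul_hop_succ h, hop_succ_mul_hop_succ (Ne.symm h)]
    exact (((this.smul_left _).smul_left _).smul_right _).smul_right _
  have hsum : ((List.finRange m).map fun j => θ • (-Complex.I) • hop j.succ lam).sum
      = θ • (-Complex.I) • tailHam m lam := by
    rw [← Fin.sum_univ_def, tailHam, Finset.smul_sum, Finset.smul_sum]
  rw [V, List.finRange_succ, List.map_cons, List.reverse_cons, List.prod_append,
    List.prod_singleton, List.map_map, W_eq_exp, ← hsum, ← exp_list_sum hcomm, List.map_map]
  simp only [Function.comp_def, W_eq_exp]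

/-- The outer rotations move half of the full rotation on the lowest qubit, which stands rightmost
in `V`, to the left end. -/
theorem V2_eq_strang {m : ℕ} (hn : 0 < m + 1) (θ lam : ℝ) : V2 hn θ lam =
    NormedSpace.exp ((θ / 2) • (-Complex.I) • hop 0 lam) *
      NormedSpace.exp (θ • (-Complex.I) • tailHam m lam) *
      NormedSpace.exp ((θ / 2) • (-Complex.I) • hop 0 lam) := by
  have h : NormedSpace.exp (θ • (-Complex.I) • hop (0 : Fin (m + 1)) lam) *
      NormedSpace.exp ((-θ / 2) • (-Complex.I) • hop 0 lam)
      = NormedSpace.exp ((θ / 2) • (-Complex.I) • hop 0 lam) := by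
    rw [← Matrix.exp_add_of_commute, ← add_smul]
    · congr 2; ring
    · exact ((Commute.refl _).smul_left _).smul_right _
  rw [V2, V_eq_exp, W_eq_exp, W_eq_exp, Fin.mk_zero, mul_assoc, mul_assoc, h, mul_assoc]

/-- The error of a second-order step on one register. -/
theorem norm_exp_sub_V2_le {n : ℕ} (hn : 0 < n) (θ lam : ℝ) :
    ‖NormedSpace.exp (θ • (-Complex.I) • regHam n lam) - V2 hn θ lam‖ ≤ n / 3 * |θ| ^ 3 := by
  obtain ⟨m, rfl⟩ : ∃ m, n = m + 1 := ⟨n - 1, by omega⟩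
  have hH : regHam (m + 1) lam = hop 0 lam + tailHam m lam := by
    rw [regHam, Fin.sum_univ_succ, tailHam]
  rw [V2_eq_strang]
  rcases Nat.eq_zero_or_pos m with rfl | hm
  -- On one qubit there is nothing to split, so the step is exact.
  · have hB : tailHam 0 lam = 0 := by simp [tailHam]
    rw [hH, hB, add_zero, smul_zero, smul_zero, NormedSpace.exp_zero, mul_one,
      ← Matrix.exp_add_of_commute _ _ (Commute.refl _), ← add_smul, add_halves, sub_self, norm_zero]
    positivity
  · have hnorm : ∀ X : Op (Fin (m + 1)), ‖X‖ ≤ 1 → ‖(-Complex.I) • X‖ ≤ 1 := fun X hX => by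
      rw [norm_smul, norm_neg, Complex.norm_I, one_mul]; exact hX
    have h := norm_strang_sub_exp_le (X := (-Complex.I) • hop (0 : Fin (m + 1)) lam)
      (B := (-Complex.I) • tailHam m lam)
      (norm_exp_smul_le (hop_conjTranspose 0 lam)) (norm_exp_smul_le (tailHam_conjTranspose m lam))
      (fun t => by
        rw [← smul_add, ← hH]; exact norm_exp_smul_le (regHam_conjTranspose _ lam) t)
      (hnorm _ (norm_hop_le 0 lam)) (hnorm _ (norm_tailHam_le m lam)) θ
    rw [← smul_add, ← hH] at h
    refine h.trans ?_
    -- The constant `1 / 2` is at most `n / 3` from `n = 2` on. The weaker bound fixes the number of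
    -- steps, and through it the leading constant `3√3`.
    have hm' : (1 : ℝ) ≤ m := by exact_mod_cast hm
    have h3 : 0 ≤ |θ| ^ 3 := by positivity
    push_cast
    nlinarith

end StepError

/-! ### Several registers in parallel -/

section Registers

variable {d n : ℕ}

theorem regTensor_mul (A B : Fin d → Op (Fin n)) :
    regTensor A * regTensor B = regTensor fun α => A α * B α := by
  ext x y
  simp only [regTensor, Matrix.mul_apply, Matrix.of_apply, ← Finset.prod_mul_distrib]
  rw [Fintype.prod_sum fun α z =>
    A α (fun k => x (α, k)) z * B α z (fun k => y (α, k))]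
  exact Fintype.sum_equiv (Equiv.curry _ _ _) _ _ fun z => rfl

theorem regTensor_tensor (B : Fin d → Fin n → Matrix (Fin 2) (Fin 2) ℂ) :
    regTensor (fun α => tensor (B α)) = tensor fun p : Fin d × Fin n => B p.1 p.2 := by
  ext x y
  simp only [regTensor, tensor, Matrix.of_apply]
  exact (Fintype.prod_prod_type (f := fun p : Fin d × Fin n => B p.1 p.2 (x p) (y p))).symm

theorem regTensor_one : regTensor (fun _ : Fin d => (1 : Op (Fin n))) = 1 := by
  simp_rw [← tensor_one]
  exact regTensor_tensor _

theorem regTensor_conjTranspose (A : Fin d → Op (Fin n)) :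
    (regTensor A).conjTranspose = regTensor fun α => (A α).conjTranspose := by
  ext x y
  simp [regTensor, Matrix.conjTranspose_apply]

theorem onReg_apply (α : Fin d) (A : Op (Fin n)) (x y : Fin d × Fin n → Fin 2) :
    onReg α A x y = A (fun k => x (α, k)) (fun k => y (α, k)) *
      ∏ β ∈ Finset.univ.erase α, (1 : Op (Fin n)) (fun k => x (β, k)) (fun k => y (β, k)) := by
  rw [onReg, regTensor, Matrix.of_apply, ← Finset.mul_prod_erase _ _ (Finset.mem_univ α)]
  congr 1
  · simp
  · exact Finset.prod_congr rfl fun β hβ => by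
      simp [Function.update_of_ne (Finset.ne_of_mem_erase hβ)]

theorem onReg_one (α : Fin d) : onReg α (1 : Op (Fin n)) = 1 := by
  rw [onReg, ← regTensor_one]
  congr 1
  exact Function.update_eq_self α _

/-- The star homomorphism sending an operator on `n` qubits to its action on register `α`. -/
def onRegHom (α : Fin d) : Op (Fin n) →⋆ₐ[ℂ] Op (Fin d × Fin n) where
  toFun := onReg α
  map_one' := onReg_one α
  map_mul' A B := by
    rw [onReg, onReg, onReg, regTensor_mul]
    congr 1
    ext1 k
    by_cases h : k = α
    · subst h; simp
    · simp [Function.update_of_ne h]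
  map_zero' := by
    ext x y
    simp [onReg_apply]
  map_add' A B := by
    ext x y
    simp only [Matrix.add_apply, onReg_apply, add_mul]
  commutes' c := by
    rw [Algebra.algebraMap_eq_smul_one, Algebra.algebraMap_eq_smul_one, ← onReg_one α]
    ext x y
    simp only [Matrix.smul_apply, onReg_apply, smul_eq_mul, mul_assoc]
  map_star' A := by
    rw [Matrix.star_eq_conjTranspose, Matrix.star_eq_conjTranspose, onReg, onReg,
      regTensor_conjTranspose]
    congr 1
    ext1 k
    by_cases h : k = α
    · subst h; simp
    · simp [Function.update_of_ne h]

/-- Star homomorphisms of C⋆-algebras are contractive. -/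
theorem norm_onReg_le (α : Fin d) (A : Op (Fin n)) : ‖onReg α A‖ ≤ ‖A‖ :=
  NonUnitalStarAlgHom.norm_apply_le (onRegHom α) A

theorem onReg_exp (α : Fin d) (A : Op (Fin n)) :
    onReg α (NormedSpace.exp A) = NormedSpace.exp (onReg α A) := by
  let +nondep : NormedAlgebra ℚ (Op (Fin n)) := .restrictScalars ℚ ℂ _
  let +nondep : NormedAlgebra ℚ (Op (Fin d × Fin n)) := .restrictScalars ℚ ℂ _
  have hc : Continuous (onRegHom (n := n) α) :=
    AddMonoidHomClass.continuous_of_bound (onRegHom α) 1 fun A => by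
      rw [one_mul]; exact norm_onReg_le α A
  exact NormedSpace.map_exp (onRegHom (n := n) α) hc A

theorem onReg_commute {α β : Fin d} (h : α ≠ β) (A B : Op (Fin n)) :
    Commute (onReg α A) (onReg β B) := by
  rw [Commute, SemiconjBy, onReg, onReg, regTensor_mul, regTensor_mul]
  congr 1
  ext1 k
  by_cases h1 : k = α
  · subst h1; simp [Function.update_of_ne h]
  · simp [Function.update_of_ne h1]

theorem prod_reverse_onReg (A : Fin d → Op (Fin n)) {l : List (Fin d)} (hl : l.Nodup) :
    (l.map fun α => onReg α (A α)).reverse.prod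
      = regTensor fun α => if α ∈ l then A α else 1 := by
  induction l with
  | nil => simp [regTensor_one]
  | cons a l ih =>
    rw [List.nodup_cons] at hl
    rw [List.map_cons, List.reverse_cons, List.prod_append, List.prod_singleton, ih hl.2, onReg,
      regTensor_mul]
    congr 1
    ext1 k
    by_cases h : k = a
    · subst h; simp [hl.1]
    · simp [h]

/-- The reversed order matches the operator of a concatenation of circuits, and a product allows
telescoping over the registers. -/
theorem regTensor_eq_prod (A : Fin d → Op (Fin n)) :
    regTensor A = ((List.finRange d).map fun α => onReg α (A α)).reverse.prod := by
  rw [prod_reverse_onReg A (List.nodup_finRange d)]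
  simp

theorem norm_regTensor_sub_le {A B : Fin d → Op (Fin n)} (hA : ∀ α, ‖A α‖ ≤ 1)
    (hB : ∀ α, ‖B α‖ ≤ 1) : ‖regTensor A - regTensor B‖ ≤ ∑ α, ‖A α - B α‖ := by
  have h := norm_list_prod_sub_le (fun α => onReg α (A α)) (fun α => onReg α (B α))
    (fun α => (norm_onReg_le α _).trans (hA α)) (fun α => (norm_onReg_le α _).trans (hB α))
    (List.finRange d).reverse
  rw [regTensor_eq_prod, regTensor_eq_prod, ← List.map_reverse, ← List.map_reverse]
  refine h.trans ?_
  rw [List.map_reverse, List.sum_reverse, ← Fin.sum_univ_def]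
  refine Finset.sum_le_sum fun α _ => ?_
  rw [show onReg α (A α) - onReg α (B α) = onReg α (A α - B α) from
    (map_sub (onRegHom α) _ _).symm]
  exact norm_onReg_le α _

theorem exp_sum_onReg (X : Fin d → Op (Fin n)) :
    NormedSpace.exp (∑ α, onReg α (X α)) = regTensor fun α => NormedSpace.exp (X α) := by
  rw [regTensor_eq_prod, Fin.sum_univ_def, ← exp_list_sum, List.map_map]
  · simp only [Function.comp_def, onReg_exp]
  · intro Y hY Z hZ
    obtain ⟨α, -, rfl⟩ := List.mem_map.mp hY
    obtain ⟨β, -, rfl⟩ := List.mem_map.mp hZ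
    by_cases h : α = β
    · subst h; exact Commute.refl _
    · exact onReg_commute h _ _

theorem onReg_onQubit (α : Fin d) (q : Fin n) (A : Matrix (Fin 2) (Fin 2) ℂ) :
    onReg α (onQubit q A) = onQubit (α, q) A := by
  have : Function.update (fun _ => (1 : Op (Fin n))) α (onQubit q A)
      = fun β => tensor (fun k =>
          Function.update (fun _ => (1 : Matrix (Fin 2) (Fin 2) ℂ)) (α, q) A (β, k)) := by
    ext1 β
    by_cases h : β = α
    · subst h
      rw [Function.update_self, onQubit]
      congr 1
      ext1 k
      by_cases hk : k = q
      · subst hk; simp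
      · rw [Function.update_of_ne hk, Function.update_of_ne (by simpa using hk)]
    · rw [Function.update_of_ne h, ← tensor_one]
      congr 1
      ext1 k
      rw [Function.update_of_ne (by simp [h])]
  rw [onReg, this]
  exact regTensor_tensor _

theorem onReg_cnot (α : Fin d) {c t : Fin n} (h : c ≠ t) :
    onReg α (cnot c t) = cnot (α, c) (α, t) := by
  have h' : (α, c) ≠ (α, t) := by simpa using h
  rw [cnot_eq h, cnot_eq h', ← onReg_onQubit, ← onReg_onQubit, ← onReg_onQubit]
  exact (map_add (onRegHom α) _ _).trans (by rw [map_mul]; rfl)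

/-- A gate acting on register `α`. -/
def Gate.onReg (α : Fin d) : Gate (Fin n) → Gate (Fin d × Fin n)
  | .single q U => .single (α, q) U
  | .cnot c t h => .cnot (α, c) (α, t) (by simpa using h)

/-- A circuit acting on register `α`. -/
def Circuit.onReg (α : Fin d) (C : Circuit (Fin n)) : Circuit (Fin d × Fin n) :=
  C.map (Gate.onReg α)

theorem Gate.toOp_onReg (α : Fin d) (g : Gate (Fin n)) :
    (g.onReg α).toOp = QSim.onReg α g.toOp := by
  cases g with
  | single q U => exact (onReg_onQubit α q U.1).symm
  | cnot c t h => exact (onReg_cnot α h).symm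

theorem Circuit.toOp_onReg (α : Fin d) (C : Circuit (Fin n)) :
    (Circuit.onReg α C).toOp = QSim.onReg α C.toOp := by
  induction C with
  | nil => exact (onReg_one α).symm
  | cons g C ih =>
    have : Circuit.onReg α (g :: C) = g.onReg α :: Circuit.onReg α C := rfl
    rw [this, toOp_cons, ih, toOp_cons, Gate.toOp_onReg]
    exact (map_mul (onRegHom α) _ _).symm

theorem Circuit.nonlocalCount_onReg (α : Fin d) (C : Circuit (Fin n)) :
    (Circuit.onReg α C).nonlocalCount = C.nonlocalCount := by
  rw [Circuit.nonlocalCount, Circuit.onReg, List.map_map, Circuit.nonlocalCount]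
  congr 1
  exact List.map_congr_left fun g _ => by cases g <;> rfl

/-- The circuit for one second-order step on all registers. -/
def stepCircuit (d n : ℕ) (θ lam : Fin d → ℝ) : Circuit (Fin d × Fin n) :=
  if hn : 0 < n then
    ((List.finRange d).map fun α => Circuit.onReg α (v2Circuit hn (θ α) (lam α))).flatten
  -- A default for empty registers, about which nothing is claimed.
  else []

theorem toOp_stepCircuit (hn : 0 < n) (θ lam : Fin d → ℝ) :
    (stepCircuit d n θ lam).toOp = stepOp hn θ lam := by
  rw [stepCircuit, dif_pos hn, Circuit.toOp_flatten, List.map_map, stepOp, regTensor_eq_prod]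
  simp only [Function.comp_def, Circuit.toOp_onReg, toOp_v2Circuit]

theorem nonlocalCount_stepCircuit (hn : 0 < n) (θ lam : Fin d → ℝ) :
    (stepCircuit d n θ lam).nonlocalCount = d * stepCount n := by
  rw [stepCircuit, dif_pos hn, Circuit.nonlocalCount_flatten, List.map_map]
  simp only [Function.comp_def, Circuit.nonlocalCount_onReg, nonlocalCount_v2Circuit]
  simp

theorem norm_stepOp_le (hn : 0 < n) (θ lam : Fin d → ℝ) : ‖stepOp hn θ lam‖ ≤ 1 := by
  rw [← toOp_stepCircuit]
  exact norm_le_one_of_mem_unitary (Circuit.toOp_mem_unitary _)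

theorem hamiltonian_eq (γ : ℝ) (η lam : Fin d → ℝ) :
    hamiltonian n γ η lam = ∑ α, onReg α (((γ * η α : ℝ) : ℂ) • regHam n (lam α)) := by
  rw [hamiltonian, Finset.smul_sum]
  refine Finset.sum_congr rfl fun α _ => ?_
  have h : ∀ j : Fin n, Complex.exp (Complex.I * lam α) • onReg α (sMinus j)
      + Complex.exp (-(Complex.I * lam α)) • onReg α (sPlus j) = onReg α (hop j (lam α)) := by
    intro j
    exact ((map_add (onRegHom α) _ _).trans (by rw [map_smul, map_smul]; rfl)).symm
  simp only [h]
  rw [← Finset.smul_sum, smul_smul, ← Complex.ofReal_mul]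
  refine Eq.trans ?_ (map_smul (onRegHom α) _ _).symm
  congr 1
  exact (map_sum (onRegHom α) _ _).symm

theorem exp_hamiltonian (γ τ : ℝ) (η lam : Fin d → ℝ) :
    NormedSpace.exp ((-(Complex.I * (τ : ℂ))) • hamiltonian n γ η lam) =
      regTensor fun α => NormedSpace.exp ((γ * η α * τ) • (-Complex.I) • regHam n (lam α)) := by
  rw [← exp_sum_onReg, hamiltonian_eq, Finset.smul_sum]
  congr 1
  refine Finset.sum_congr rfl fun α _ => ?_
  refine (map_smul (onRegHom α) _ _).symm.trans ?_
  change onReg α _ = onReg α _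
  congr 1
  rw [smul_smul, ← Complex.coe_smul, smul_smul]
  congr 1
  push_cast
  ring

/-- The error of a second-order step on all registers. -/
theorem norm_exp_sub_stepOp_le (hn : 0 < n) (γ τ : ℝ) (η lam : Fin d → ℝ) :
    ‖NormedSpace.exp ((-(Complex.I * (τ : ℂ))) • hamiltonian n γ η lam)
      - stepOp hn (fun α => γ * η α * τ) lam‖ ≤ n / 3 * (|γ| ^ 3 * |τ| ^ 3 * ∑ α, |η α| ^ 3) := by
  rw [exp_hamiltonian, stepOp]
  refine (norm_regTensor_sub_le (fun α => norm_exp_smul_le (regHam_conjTranspose _ _) _)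
    (fun α => ?_)).trans ?_
  · rw [← toOp_v2Circuit]
    exact norm_le_one_of_mem_unitary (Circuit.toOp_mem_unitary _)
  · rw [Finset.mul_sum, Finset.mul_sum]
    refine Finset.sum_le_sum fun α _ => (norm_exp_sub_V2_le hn _ _).trans_eq ?_
    rw [abs_mul, abs_mul, mul_pow, mul_pow]
    ring

theorem norm_exp_hamiltonian_le (γ τ : ℝ) (η lam : Fin d → ℝ) :
    ‖NormedSpace.exp ((-(Complex.I * (τ : ℂ))) • hamiltonian n γ η lam)‖ ≤ 1 := by
  rw [exp_hamiltonian, regTensor_eq_prod]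
  refine norm_list_prod_le_one ?_
  simp only [List.mem_reverse, List.mem_map, List.mem_finRange, true_and, forall_exists_index,
    forall_apply_eq_imp_iff]
  exact fun α => (norm_onReg_le α _).trans (norm_exp_smul_le (regHam_conjTranspose _ _) _)

end Registers

/-! ### Choice of the number of steps, total error and total count -/

namespace Task

/-- The number of second-order steps. -/
def reps (P : Task) : ℕ := max 1 ⌈Real.sqrt (P.load / 3)⌉₊

/-- The circuit for the evolution. -/
def circuit (P : Task) : Circuit (Fin P.d × Fin P.n) :=
  (stepCircuit P.d P.n (P.angles P.reps) P.lam).iter P.reps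

theorem reps_pos (P : Task) : 0 < P.reps := lt_of_lt_of_le one_pos (le_max_left _ _)

theorem sqrt_le_reps (P : Task) : Real.sqrt (P.load / 3) ≤ P.reps :=
  (Nat.le_ceil _).trans (by exact_mod_cast le_max_right _ _)

theorem reps_le (P : Task) : (P.reps : ℝ) ≤ Real.sqrt (P.load / 3) + 1 := by
  rw [reps, Nat.cast_max, max_le_iff]
  exact ⟨by simpa using Real.sqrt_nonneg (P.load / 3), (Nat.ceil_lt_add_one (Real.sqrt_nonneg _)).le⟩

theorem load_nonneg (P : Task) : 0 ≤ P.load := by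
  have := P.T_nonneg
  have := P.ε_pos
  unfold load
  positivity

theorem load_le (P : Task) : P.load ≤ 3 * (P.reps : ℝ) ^ 2 := by
  have h := (Real.sqrt_le_left (by positivity)).mp P.sqrt_le_reps
  linarith

/-- The step error is cubic in `T / r` and is multiplied by `r` steps, which gives `load * ε / (3 *
r ^ 2)`; `load_le` makes this at most `ε`. -/
theorem norm_evolution_sub_circuit_le (P : Task) : ‖P.evolution - P.circuit.toOp‖ ≤ P.ε := by
  have hr : (0 : ℝ) < P.reps := by exact_mod_cast P.reps_pos
  have hr' : (P.reps : ℂ) ≠ 0 := by exact_mod_cast P.reps_pos.ne'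
  have hε := P.ε_pos
  have hT : |P.T / P.reps| = P.T / P.reps := abs_of_nonneg (div_nonneg P.T_nonneg hr.le)
  have hev : P.evolution = NormedSpace.exp
      ((-(Complex.I * ((P.T / P.reps : ℝ) : ℂ))) • hamiltonian P.n P.γ P.η P.lam) ^ P.reps := by
    rw [← Matrix.exp_nsmul, evolution, H]
    congr 1
    rw [← Nat.cast_smul_eq_nsmul ℂ, smul_smul]
    congr 1
    push_cast
    field_simp
  rw [hev, circuit, Circuit.toOp_iter, toOp_stepCircuit P.n_pos]
  refine (norm_pow_sub_pow_le (norm_exp_hamiltonian_le _ _ _ _) (norm_stepOp_le _ _ _) _).trans ?_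
  calc _ ≤ (P.reps : ℝ) *
        (P.n / 3 * (|P.γ| ^ 3 * |P.T / P.reps| ^ 3 * ∑ α, |P.η α| ^ 3)) := by
        gcongr
        exact norm_exp_sub_stepOp_le P.n_pos _ _ _ _
    _ = P.load * P.ε / (3 * (P.reps : ℝ) ^ 2) := by
        rw [hT, load]
        field_simp
    _ ≤ P.ε := by
        rw [div_le_iff₀ (by positivity), mul_comm]
        gcongr
        exact P.load_le

/-- Separates `B` into the quadratic gate count of a step on `d` registers and the square root that
governs the number of steps. -/
theorem scale_eq (P : Task) : P.scale = P.d * (P.n : ℝ) ^ 2 * Real.sqrt P.load := by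
  have h1 : ∀ x : ℝ, 0 ≤ x → Real.sqrt (x ^ 3) = x ^ (3 / 2 : ℝ) := fun x hx => by
    rw [Real.sqrt_eq_rpow, ← Real.rpow_natCast_mul hx]; norm_num
  have h2 : (P.n : ℝ) ^ (5 / 2 : ℝ) = (P.n : ℝ) ^ 2 * Real.sqrt P.n := by
    have : (0 : ℝ) < P.n := by exact_mod_cast P.n_pos
    rw [Real.sqrt_eq_rpow, ← Real.rpow_natCast, ← Real.rpow_add this]
    norm_num
  have hT := P.T_nonneg
  rw [scale, load, Real.sqrt_div (by positivity), Real.sqrt_mul (by positivity),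
    Real.sqrt_mul (by positivity), Real.sqrt_mul (by positivity), h1 _ (abs_nonneg _), h1 _ hT, h2]
  ring

theorem nonlocalCount_circuit (P : Task) :
    P.circuit.nonlocalCount = P.reps * (P.d * stepCount P.n) := by
  rw [circuit, Circuit.nonlocalCount_iter, nonlocalCount_stepCircuit P.n_pos]

theorem sqrt_load_div_three (P : Task) :
    Real.sqrt (P.load / 3) = Real.sqrt 3 / 3 * Real.sqrt P.load := by
  have h3 : Real.sqrt 3 ^ 2 = 3 := Real.sq_sqrt (by norm_num)
  have : Real.sqrt 3 ≠ 0 := by positivity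
  rw [Real.sqrt_div P.load_nonneg]
  field_simp
  rw [h3]

theorem nonlocalCount_circuit_le {c : ℝ} (hc : 0 < c) (P : Task) (h : c ≤ P.load) :
    (P.circuit.nonlocalCount : ℝ) ≤ 9 * (Real.sqrt 3 / 3 + 1 / Real.sqrt c) * P.scale := by
  have hsc : 0 < Real.sqrt c := Real.sqrt_pos.mpr hc
  have h1 : (P.reps : ℝ) ≤ (Real.sqrt 3 / 3 + 1 / Real.sqrt c) * Real.sqrt P.load := by
    -- The lower bound on `load` absorbs the additive 1 from rounding up.
    have h2 : 1 ≤ 1 / Real.sqrt c * Real.sqrt P.load := by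
      rw [one_div, inv_mul_eq_div, one_le_div hsc]
      exact Real.sqrt_le_sqrt h
    have := P.reps_le
    rw [sqrt_load_div_three] at this
    linarith
  have h2 := (stepCount_bounds P.n).1
  rw [nonlocalCount_circuit, scale_eq]
  push_cast
  calc _ ≤ ((Real.sqrt 3 / 3 + 1 / Real.sqrt c) * Real.sqrt P.load) *
        (P.d * (9 * (P.n : ℝ) ^ 2)) := by gcongr
    _ = _ := by ring

theorem abs_nonlocalCount_sub_le {δ : ℝ} (hδ : 0 < δ) (P : Task) (hn : 10 / δ ≤ P.n)
    (hl : 12 / δ ^ 2 ≤ P.load) :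
    |(P.circuit.nonlocalCount : ℝ) - 3 * Real.sqrt 3 * P.scale|
      ≤ δ * (3 * Real.sqrt 3 * P.scale) := by
  have hn0 : (0 : ℝ) < P.n := by exact_mod_cast P.n_pos
  set x := Real.sqrt (P.load / 3) with hx
  have hx0 : 0 ≤ x := Real.sqrt_nonneg _
  have hδx : 2 ≤ δ * x := by
    have : 2 / δ ≤ x := by
      refine Real.le_sqrt_of_sq_le ?_
      calc (2 / δ) ^ 2 = (12 / δ ^ 2) / 3 := by rw [div_pow]; ring
        _ ≤ P.load / 3 := by gcongr
    rwa [div_le_iff₀ hδ, mul_comm] at this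
  have hδn : 10 ≤ δ * P.n := by
    rwa [div_le_iff₀ hδ, mul_comm] at hn
  have hscale : 3 * Real.sqrt 3 * P.scale = P.d * (9 * (P.n : ℝ) ^ 2 * x) := by
    rw [scale_eq, hx, sqrt_load_div_three]
    ring
  obtain ⟨hs1, hs2⟩ := stepCount_bounds P.n
  have hr1 := P.sqrt_le_reps
  have hr2 := P.reps_le
  rw [← hx] at hr1 hr2
  set s : ℝ := (stepCount P.n : ℝ) with hs
  have hs0 : 0 ≤ s := by positivity
  -- From below only the deficit `41 n` of the step count matters, from above only the rounding of
  -- the number of steps. The thresholds `δ n ≥ 10` and `δ x ≥ 2` absorb them with room to spare.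
  have key : |P.reps * s - 9 * (P.n : ℝ) ^ 2 * x| ≤ δ * (9 * (P.n : ℝ) ^ 2 * x) := by
    have e1 : 9 * (P.n : ℝ) ^ 2 * x - 41 * P.n * x ≤ P.reps * s := by
      calc _ = x * (9 * (P.n : ℝ) ^ 2 - 41 * P.n) := by ring
        _ ≤ x * s := by gcongr; linarith
        _ ≤ P.reps * s := by gcongr
    have e2 : P.reps * s ≤ (x + 1) * (9 * (P.n : ℝ) ^ 2) := by gcongr
    have e3 : 41 * P.n * x ≤ δ * (9 * (P.n : ℝ) ^ 2 * x) := by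
      have : 10 * ((P.n : ℝ) * x) ≤ δ * P.n * (P.n * x) := by gcongr
      nlinarith [mul_nonneg hn0.le hx0]
    have e4 : 9 * (P.n : ℝ) ^ 2 ≤ δ * (9 * (P.n : ℝ) ^ 2 * x) := by
      have : 2 * (9 * (P.n : ℝ) ^ 2) ≤ δ * x * (9 * (P.n : ℝ) ^ 2) := by gcongr
      nlinarith [sq_nonneg (P.n : ℝ)]
    rw [abs_le]
    constructor <;> linarith
  rw [hscale, nonlocalCount_circuit]
  push_cast
  rw [← hs]
  calc _ = |(P.d : ℝ) * (P.reps * s - 9 * (P.n : ℝ) ^ 2 * x)| := by congr 1; ring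
    _ = (P.d : ℝ) * |P.reps * s - 9 * (P.n : ℝ) ^ 2 * x| := by rw [abs_mul, Nat.abs_cast]
    _ ≤ (P.d : ℝ) * (δ * (9 * (P.n : ℝ) ^ 2 * x)) := by gcongr
    _ = _ := by ring

end Task

end QSim
end

/-! ### The main theorem -/

theorem theorem2 :
    ∃ (step : ∀ d n : ℕ, (Fin d → ℝ) → (Fin d → ℝ) → QSim.Circuit (Fin d × Fin n))
      (r : QSim.Task → ℕ) (circuit : ∀ P : QSim.Task, QSim.Circuit (Fin P.d × Fin P.n)),
      -- `step` implements one second-order step on the `dn` qubits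
      (∀ (d n : ℕ) (hn : 0 < n) (θ lam : Fin d → ℝ),
        (step d n θ lam).toOp = QSim.stepOp hn θ lam) ∧
      -- the circuit repeats the step of length `T / r` exactly `r` times
      (∀ P : QSim.Task, 0 < r P ∧
        circuit P = (step P.d P.n (P.angles (r P)) P.lam).iter (r P)) ∧
      -- it implements the evolution within additive error `ε` in operator norm
      (∀ P : QSim.Task, ‖P.evolution - (circuit P).toOp‖ ≤ P.ε) ∧
      -- the number of its non-local gates is of the claimed order
      (∀ c : ℝ, 0 < c → ∃ K : ℝ, ∀ P : QSim.Task, c ≤ P.load →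
        ((circuit P).nonlocalCount : ℝ) ≤ K * P.scale) ∧
      -- with leading term `3√3` times `scale`
      (∀ δ : ℝ, 0 < δ → ∃ (n₀ : ℕ) (R : ℝ), ∀ P : QSim.Task, n₀ ≤ P.n → R ≤ P.load →
        |((circuit P).nonlocalCount : ℝ) - 3 * Real.sqrt 3 * P.scale|
          ≤ δ * (3 * Real.sqrt 3 * P.scale)) := by
  refine ⟨QSim.stepCircuit, QSim.Task.reps, QSim.Task.circuit,
    fun d n hn θ lam => QSim.toOp_stepCircuit hn θ lam, fun P => ⟨P.reps_pos, rfl⟩,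
    fun P => P.norm_evolution_sub_circuit_le,
    fun c hc => ⟨_, fun P hP => P.nonlocalCount_circuit_le hc hP⟩,
    fun δ hδ => ⟨⌈10 / δ⌉₊, 12 / δ ^ 2, fun P hn hl =>
      P.abs_nonlocalCount_sub_le hδ ((Nat.le_ceil _).trans (by exact_mod_cast hn)) hl⟩⟩
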